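/- Let $\mathcal T$ be the set of (finite or infinite, locally finite) rooted planar trees whose root has exactly one offspring. For $T\in\mathcal T$ let $|T|$ denote the number of edges of $T$, let $h(T)$ denote its height, let $D_r(T)$ denote the set of vertices at graph distance $r$ from the root, and for $r\ge 1$ let $B_r(T)$ be the subtree spanned by the vertices at distance at most $r$ from the root; $|B_r(T)|=\sum_{s=1}^r|D_s(T)|$ is its number of edges. Equip $\mathcal T$ with the metric $\mathrm{dist}(T,T')=\inf\{1/r : r\in\mathbb N,\ r\ge 1,\ B_r(T)=B_r(T')\}$ and its Borel $\sigma$-algebra. For $\mu\in\mathbb R$ and $N\ge 1$ let $\nu^{(\mu)}_N$ be the probability measure on $\mathcal T$ that gives every tree $T$ with $|T|=N$ the mass $e^{-\mu h(T)}/Z^{(\mu)}_N$, where $Z^{(\mu)}_N=\sum_{|T|=N}e^{-\mu h(T)}$. Let $\mu>0$. Then $\nu^{(\mu)}_N$ converges weakly, as $N\to\infty$, to a Borel probability measure $\nu^{(\mu)}$ on $\mathcal T$. Let $\mathbb E_\mu$ denote the expectation with respect to $\nu^{(\mu)}$. For every $r\ge1$ the variables $|D_r|$ and $|B_r|$ are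 $\nu^{(\mu)}$-integrable, and, as $r\to\infty$ (with $\mu$ fixed), i) $\mathbb E_\mu(|D_r|)=\mu r^2\bigl(1+O(\tfrac1r)\bigr)$, ii) $\mathbb E_\mu(|B_r|)=\tfrac13\mu r^3\bigl(1+O(\tfrac1r)\bigr)$. -/

import Mathlib

open Filter Topology MeasureTheory Asymptotics

/-- A rooted planar tree whose root has exactly one offspring.
The vertices at height `r` form the ordered finite set
`D r = {0, 1, …, levelCard r - 1}` (listed from left to right), and `parent r : D (r + 1) → D r` is
the order preserving parent map. `parent r` is set to `0` outside `D (r + 1)`, so that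
two such structures are equal exactly when the trees are isomorphic through order preserving
bijections of all levels. -/
@[ext]
structure PlanarTree where
  levelCard : ℕ → ℕ
  parent : ℕ → ℕ → ℕ
  levelCard_zero : levelCard 0 = 1
  levelCard_one : levelCard 1 = 1
  parent_lt : ∀ r i, i < levelCard (r + 1) → parent r i < levelCard r
  parent_mono : ∀ r i j, i ≤ j → j < levelCard (r + 1) → parent r i ≤ parent r j
  parent_outside : ∀ r i, levelCard (r + 1) ≤ i → parent r i = 0

namespace PlanarTree

/-- The edge set `E(T)`: every vertex `(r + 1, i)` at height `r + 1` is joined to its parent. -/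
def edges (T : PlanarTree) : Set (Sym2 (ℕ × ℕ)) :=
  {e | ∃ r i, i < T.levelCard (r + 1) ∧ e = s((r + 1, i), (r, T.parent r i))}

/-- The size `|T| = |E(T)|`. -/
noncomputable def size (T : PlanarTree) : ℕ∞ := T.edges.encard

/-- The height of a tree, i.e. the supremum of the heights of its vertices
(`⊤` if and only if the tree is infinite). -/
noncomputable def height (T : PlanarTree) : ℕ∞ :=
  ⨆ r ∈ {r : ℕ | T.levelCard r ≠ 0}, (r : ℕ∞)

/-- `B_r(T)`: the subtree spanned by the vertices at height at most `r`. Only used for `r ≥ 1`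
(for `r = 0` the value is `B_1(T)`). -/
def ball (T : PlanarTree) (r : ℕ) : PlanarTree where
  levelCard s := if s ≤ max r 1 then T.levelCard s else 0
  parent s i := if s < max r 1 then T.parent s i else 0
  levelCard_zero := by simp [T.levelCard_zero]
  levelCard_one := by simp [T.levelCard_one]
  parent_lt s i h := by
    by_cases hs : s + 1 ≤ max r 1
    · rw [if_pos hs] at h
      rw [if_pos (by omega), if_pos (by omega)]
      exact T.parent_lt s i h
    · rw [if_neg hs] at h
      omega
  parent_mono s i j hij h := by
    by_cases hs : s + 1 ≤ max r 1
    · rw [if_pos hs] at h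
      rw [if_pos (by omega), if_pos (by omega)]
      exact T.parent_mono s i j hij h
    · rw [if_neg hs] at h
      omega
  parent_outside s i h := by
    by_cases hs : s + 1 ≤ max r 1
    · rw [if_pos hs] at h
      rw [if_pos (by omega)]
      exact T.parent_outside s i h
    · rw [if_neg (by omega)]

theorem ball_ball (T : PlanarTree) {r s : ℕ} (hr : r ≤ s) : (T.ball s).ball r = T.ball r := by
  ext a b
  · simp only [ball]
    split_ifs <;> first | rfl | omega
  · simp only [ball]
    split_ifs <;> first | rfl | omega

theorem ball_eq_of_le {T T' : PlanarTree} {r s : ℕ} (hr : r ≤ s) (h : T.ball s = T'.ball s) :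
    T.ball r = T'.ball r := by
  rw [← T.ball_ball hr, h, T'.ball_ball hr]

theorem eq_of_ball_eq {T T' : PlanarTree} (h : ∀ r, 1 ≤ r → T.ball r = T'.ball r) : T = T' := by
  ext a b
  · have := congrFun (congrArg levelCard (h (a + 1) (by omega))) a
    simpa [ball] using this
  · have := congrFun (congrFun (congrArg parent (h (a + 1) (by omega))) a) b
    simpa [ball] using this

/-- The set of all `1 / r`, `r ≥ 1`, such that the balls of radius `r` around the roots agree. -/
def agreement (T T' : PlanarTree) : Set ℝ :=
  {a | ∃ r : ℕ, 1 ≤ r ∧ T.ball r = T'.ball r ∧ a = 1 / (r : ℝ)}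

theorem agreement_nonneg {T T' : PlanarTree} {a : ℝ} (ha : a ∈ agreement T T') : 0 ≤ a := by
  obtain ⟨r, -, -, rfl⟩ := ha
  positivity

theorem agreement_bddBelow (T T' : PlanarTree) : BddBelow (agreement T T') :=
  ⟨0, fun _ ha => agreement_nonneg ha⟩

theorem agreement_nonempty (T T' : PlanarTree) : (agreement T T').Nonempty := by
  refine ⟨1 / ((1 : ℕ) : ℝ), 1, le_rfl, ?_, rfl⟩
  ext a b
  · simp only [ball]
    split_ifs with h
    · have : a = 0 ∨ a = 1 := by simp at h; omega
      rcases this with rfl | rfl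
      · rw [T.levelCard_zero, T'.levelCard_zero]
      · rw [T.levelCard_one, T'.levelCard_one]
    · rfl
  · simp only [ball]
    split_ifs with h
    · obtain rfl : a = 0 := by simpa using h
      have key : ∀ S : PlanarTree, S.parent 0 b = 0 := by
        intro S
        by_cases hb : b < S.levelCard (0 + 1)
        · have := S.parent_lt 0 b hb
          rw [S.levelCard_zero] at this
          omega
        · exact S.parent_outside 0 b (by omega)
      rw [key, key]
    · rfl

/-- `dist T T' = inf {1 / r | r ≥ 1, B_r(T) = B_r(T')}`. -/
noncomputable instance : MetricSpace PlanarTree where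
  dist T T' := sInf (agreement T T')
  dist_self T := by
    refine le_antisymm ?_ (Real.sInf_nonneg fun _ ha => agreement_nonneg ha)
    refine le_of_forall_pos_le_add fun ε hε => ?_
    obtain ⟨n, hn⟩ := exists_nat_one_div_lt hε
    have hmem : 1 / ((n + 1 : ℕ) : ℝ) ∈ agreement T T := ⟨n + 1, by omega, rfl, rfl⟩
    have := csInf_le (agreement_bddBelow T T) hmem
    push_cast at this
    linarith
  dist_comm T T' := by
    congr 1
    ext a
    constructor <;> rintro ⟨r, hr, h, rfl⟩ <;> exact ⟨r, hr, h.symm, rfl⟩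
  dist_triangle T T' T'' := by
    refine le_of_forall_pos_le_add fun ε hε => ?_
    obtain ⟨a, ha, ha'⟩ :=
      exists_lt_of_csInf_lt (agreement_nonempty T T') (lt_add_of_pos_right _ (half_pos hε))
    obtain ⟨b, hb, hb'⟩ :=
      exists_lt_of_csInf_lt (agreement_nonempty T' T'') (lt_add_of_pos_right _ (half_pos hε))
    have ha0 := agreement_nonneg ha
    have hb0 := agreement_nonneg hb
    obtain ⟨r, hr, h, rfl⟩ := ha
    obtain ⟨s, hs, h', rfl⟩ := hb
    rcases le_total r s with hrs | hrs
    · have := csInf_le (agreement_bddBelow T T'')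
        ⟨r, hr, h.trans (ball_eq_of_le hrs h'), rfl⟩
      linarith
    · have := csInf_le (agreement_bddBelow T T'')
        ⟨s, hs, (ball_eq_of_le hrs h).trans h', rfl⟩
      linarith
  eq_of_dist_eq_zero {T T'} h := by
    refine eq_of_ball_eq fun r hr => ?_
    have hr0 : (0 : ℝ) < 1 / (r : ℝ) := by
      have : (0 : ℝ) < r := by exact_mod_cast hr
      positivity
    obtain ⟨a, ⟨s, hs, hss, rfl⟩, hlt⟩ :=
      exists_lt_of_csInf_lt (agreement_nonempty T T') (lt_of_eq_of_lt h hr0)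
    refine ball_eq_of_le ?_ hss
    have hs0 : (0 : ℝ) < s := by exact_mod_cast hs
    have hrr : (0 : ℝ) < r := by exact_mod_cast hr
    have := (one_div_lt_one_div hs0 hrr).mp hlt
    exact le_of_lt (by exact_mod_cast this)

noncomputable instance : MeasurableSpace PlanarTree := borel PlanarTree

instance : BorelSpace PlanarTree := ⟨rfl⟩

theorem size_eq (T : PlanarTree) :
    T.size = {p : ℕ × ℕ | p.2 < T.levelCard (p.1 + 1)}.encard := by
  have himg : T.edges = (fun p : ℕ × ℕ => s((p.1 + 1, p.2), (p.1, T.parent p.1 p.2))) ''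
      {p : ℕ × ℕ | p.2 < T.levelCard (p.1 + 1)} := by
    ext e
    constructor
    · rintro ⟨r, i, h, rfl⟩
      exact ⟨(r, i), h, rfl⟩
    · rintro ⟨⟨r, i⟩, h, rfl⟩
      exact ⟨r, i, h, rfl⟩
  rw [size, himg, Set.InjOn.encard_image]
  rintro ⟨r, i⟩ - ⟨s, j⟩ - h
  simp only [Sym2.eq_iff, Prod.mk.injEq] at h
  ext <;> simp <;> omega

theorem levelCard_pos_of_le (T : PlanarTree) {r s : ℕ} (hrs : r ≤ s) (hs : 0 < T.levelCard s) :
    0 < T.levelCard r := by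
  induction s, hrs using Nat.le_induction with
  | base => exact hs
  | succ n _ ih => exact ih (lt_of_le_of_lt (Nat.zero_le _) (T.parent_lt n 0 hs))

/-- The trees of size `N`. -/
def ofSize (N : ℕ) : Set PlanarTree := {T | T.size = (N : ℕ∞)}

theorem levelCard_le_of_mem {N : ℕ} {T : PlanarTree} (hT : T ∈ ofSize N) (r : ℕ) :
    T.levelCard (r + 1) ≤ N := by
  have h : ((fun i => (r, i)) '' (Finset.range (T.levelCard (r + 1)) : Set ℕ)).encard ≤ N := by
    rw [← show T.size = (N : ℕ∞) from hT, size_eq]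
    refine Set.encard_le_encard ?_
    rintro _ ⟨i, hi, rfl⟩
    simpa using hi
  rw [Set.InjOn.encard_image (fun a _ b _ h => (Prod.mk.inj h).2), Set.encard_coe_eq_coe_finsetCard,
    Finset.card_range] at h
  exact_mod_cast h

theorem levelCard_eq_zero_of_mem {N : ℕ} {T : PlanarTree} (hT : T ∈ ofSize N) {r : ℕ}
    (hr : N < r) : T.levelCard r = 0 := by
  by_contra hne
  have h : ((fun i => (i, 0)) '' (Finset.range r : Set ℕ)).encard ≤ N := by
    rw [← show T.size = (N : ℕ∞) from hT, size_eq]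
    refine Set.encard_le_encard ?_
    rintro _ ⟨i, hi, rfl⟩
    have hi' : i < r := by simpa using hi
    exact T.levelCard_pos_of_le (Nat.succ_le_of_lt hi') (Nat.pos_of_ne_zero hne)
  rw [Set.InjOn.encard_image (fun a _ b _ h => (Prod.mk.inj h).1), Set.encard_coe_eq_coe_finsetCard,
    Finset.card_range] at h
  have : r ≤ N := by exact_mod_cast h
  omega

theorem finite_ofSize (N : ℕ) : (ofSize N).Finite := by
  let F : ofSize N → (Fin (N + 2) → Fin (N + 2)) × (Fin (N + 2) → Fin (N + 2) → Fin (N + 2)) :=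
    fun T => (fun r => Fin.ofNat (N + 2) (T.1.levelCard r),
      fun r i => Fin.ofNat (N + 2) (T.1.parent r i))
  have hle : ∀ T ∈ ofSize N, ∀ r, T.levelCard r < N + 2 := by
    intro T hT r
    cases r with
    | zero => rw [T.levelCard_zero]; omega
    | succ r => have := levelCard_le_of_mem hT r; omega
  have hpar : ∀ T ∈ ofSize N, ∀ r i, T.parent r i < N + 2 := by
    intro T hT r i
    by_cases hi : i < T.levelCard (r + 1)
    · exact (T.parent_lt r i hi).trans (hle T hT r)
    · rw [T.parent_outside r i (by omega)]; omega
  have hF : Function.Injective F := by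
    rintro ⟨T, hT⟩ ⟨T', hT'⟩ h
    have h1 := congrArg Prod.fst h
    have h2 := congrArg Prod.snd h
    refine Subtype.ext (PlanarTree.ext (funext fun r => ?_) (funext fun r => funext fun i => ?_))
    · by_cases hr : r < N + 2
      · have := congrArg Fin.val (congrFun h1 ⟨r, hr⟩)
        simpa [F, Nat.mod_eq_of_lt (hle T hT r), Nat.mod_eq_of_lt (hle T' hT' r)] using this
      · change T.levelCard r = T'.levelCard r
        rw [levelCard_eq_zero_of_mem hT (by omega), levelCard_eq_zero_of_mem hT' (by omega)]
    · change T.parent r i = T'.parent r i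
      by_cases hr : r < N + 2 ∧ i < N + 2
      · have := congrArg Fin.val (congrFun (congrFun h2 ⟨r, hr.1⟩) ⟨i, hr.2⟩)
        simpa [F, Nat.mod_eq_of_lt (hpar T hT r i), Nat.mod_eq_of_lt (hpar T' hT' r i)] using this
      · have key : ∀ S ∈ ofSize N, S.parent r i = 0 := by
          intro S hS
          refine S.parent_outside r i ?_
          by_cases hr' : r < N + 2
          · have := hle S hS (r + 1)
            have : ¬ i < N + 2 := fun hi => hr ⟨hr', hi⟩
            omega
          · rw [levelCard_eq_zero_of_mem hS (by omega)]
            omega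
        rw [key T hT, key T' hT']
  exact Set.finite_coe_iff.mp (Finite.of_injective F hF)

/-- The linear tree with `N ≥ 1` edges (for `N = 0`, with one edge). -/
def path (N : ℕ) : PlanarTree where
  levelCard r := if r ≤ max N 1 then 1 else 0
  parent _ _ := 0
  levelCard_zero := by simp
  levelCard_one := by simp
  parent_lt r i h := by split_ifs at h ⊢ <;> omega
  parent_mono _ _ _ _ _ := le_rfl
  parent_outside _ _ _ := rfl

instance : Inhabited PlanarTree := ⟨path 1⟩

theorem path_mem_ofSize {N : ℕ} (hN : 0 < N) : path N ∈ ofSize N := by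
  have h : {p : ℕ × ℕ | p.2 < (path N).levelCard (p.1 + 1)} =
      (fun i => (i, 0)) '' (Finset.range N : Set ℕ) := by
    ext ⟨r, i⟩
    simp only [path, Set.mem_ofPred_eq, Set.mem_image, Finset.coe_range, Set.mem_Iio,
      Prod.mk.injEq]
    constructor
    · intro h
      split_ifs at h with hr
      · exact ⟨r, by omega, rfl, by omega⟩
      · omega
    · rintro ⟨a, ha, rfl, rfl⟩
      rw [if_pos (by omega)]
      omega
  change (path N).size = N
  rw [size_eq, h, Set.InjOn.encard_image (fun a _ b _ h => (Prod.mk.inj h).1),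
    Set.encard_coe_eq_coe_finsetCard, Finset.card_range]

/-- The weight `exp (-μ h(T))` of a finite tree. -/
noncomputable def weight (μ : ℝ) (T : PlanarTree) : ℝ := Real.exp (-μ * (T.height.toNat : ℝ))

/-- The finite size partition function `Z_N`, the sum of the weights of all trees of size `N`. -/
noncomputable def partitionFunction (μ : ℝ) (N : ℕ) : ℝ :=
  ∑ T ∈ (finite_ofSize N).toFinset, weight μ T

theorem partitionFunction_pos (μ : ℝ) {N : ℕ} (hN : 0 < N) : 0 < partitionFunction μ N :=
  Finset.sum_pos (fun _ _ => Real.exp_pos _)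
    ⟨path N, (finite_ofSize N).mem_toFinset.mpr (path_mem_ofSize hN)⟩

/-- The measure on the space of trees giving mass `exp (-μ h(T)) / Z_N` to every tree `T` of
size `N`. -/
noncomputable def finiteSizeMeasure (μ : ℝ) (N : ℕ) : Measure PlanarTree :=
  ∑ T ∈ (finite_ofSize N).toFinset,
    ENNReal.ofReal (weight μ T / partitionFunction μ N) • Measure.dirac T

theorem isProbabilityMeasure_finiteSizeMeasure (μ : ℝ) {N : ℕ} (hN : 0 < N) :
    IsProbabilityMeasure (finiteSizeMeasure μ N) := by
  have hZ := partitionFunction_pos μ hN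
  constructor
  simp only [finiteSizeMeasure, Measure.coe_finsetSum, Finset.sum_apply, Measure.smul_apply,
    measure_univ, smul_eq_mul, mul_one]
  rw [← ENNReal.ofReal_sum_of_nonneg (fun T _ => div_nonneg (show 0 ≤ weight μ T from (Real.exp_pos _).le) hZ.le),
    ← Finset.sum_div]
  change ENNReal.ofReal (partitionFunction μ N / partitionFunction μ N) = 1
  rw [div_self hZ.ne', ENNReal.ofReal_one]

/-- The finite size probability measures `ν_N`, `N = 1, 2, 3, …`. -/
noncomputable def finiteSizeLaw (μ : ℝ) (N : ℕ+) : ProbabilityMeasure PlanarTree :=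
  ⟨finiteSizeMeasure μ N, isProbabilityMeasure_finiteSizeMeasure μ N.pos⟩

/-- The local limit of the finite size measures: their limit in the topology
of weak convergence of probability measures. -/
noncomputable def localLimit (μ : ℝ) : ProbabilityMeasure PlanarTree :=
  limUnder atTop (finiteSizeLaw μ)

end PlanarTree

/-!
The number of trees of size `N` and height at most `m` that extend a given tree of height `r` is a
coefficient of the `k`-th power of the continued fraction `heightSeries (m - r)`, where `k` is the
number of vertices at level `r`. Partial fractions write it as a sum over the modes
`θ = π j / (h + 2)` of `(4 cos² θ)ⁿ` times a polynomial in `n sin² θ / (h + 2)`, `sin² θ` and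
`1 / (h + 2)`. Summed over the heights with weight `exp (-μ h)`, the modes have the energy
`μ h + n sin² θ ≥ μ h + π² n / h²` up to lower order terms; hence those with `j = 1` and
`h ≈ (2 π² n / μ) ^ (1 / 3)` dominate, on which the polynomial is evaluated at `(μ / 2, 0, 0)`.
So the ratios of these sums converge, and with them the probabilities of all the cylinders.

The limits over all the trees of height `r` add up to one, so the laws are tight and a cluster point
is determined by its values on the cylinders. Summing the limits level by level also gives the exact
mean `2 r - 1 + μ r (r - 1)` of the number of vertices at level `r`.
-/

open scoped ENNReal

section General

open PowerSeries in
theorem coeff_succ_X_mul_one_sub_mul_derivative {R : Type*} [CommRing R] (c : R)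
    (f : PowerSeries R) (m : ℕ) :
    coeff (m + 1) (X * (1 - C c * X) * derivative R f) =
      (m + 1) * coeff (m + 1) f - c * m * coeff m f := by
  rw [mul_assoc, coeff_succ_X_mul, sub_mul, one_mul, map_sub, mul_assoc, coeff_C_mul,
    coeff_derivative]
  cases m with
  | zero => simp
  | succ m =>
    rw [coeff_succ_X_mul, coeff_derivative]
    push_cast
    ring

theorem dvd_aeval_sub_aeval {σ R A : Type*} [CommRing R] [CommRing A] [Algebra R A] {d : A}
    {a b : σ → A} (h : ∀ i, d ∣ a i - b i) (p : MvPolynomial σ R) :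
    d ∣ MvPolynomial.aeval a p - MvPolynomial.aeval b p := by
  have hab : (fun i => Ideal.Quotient.mkₐ R (Ideal.span {d}) (a i)) =
      fun i => Ideal.Quotient.mkₐ R (Ideal.span {d}) (b i) :=
    funext fun i => Ideal.Quotient.eq.2 (Ideal.mem_span_singleton.2 (h i))
  rw [← Ideal.mem_span_singleton, ← Ideal.Quotient.eq, ← Ideal.Quotient.mkₐ_eq_mk R,
    ← AlgHom.comp_apply, ← AlgHom.comp_apply, MvPolynomial.comp_aeval, MvPolynomial.comp_aeval, hab]

theorem sum_cos_nat_mul_pi_div {M k : ℕ} (hk : 0 < k) (hkM : k < 2 * M) :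
    ∑ j ∈ Finset.range M, Real.cos (k * (Real.pi * j / M)) = (1 - (-1) ^ k) / 2 := by
  have hM : (0 : ℝ) < M := by exact_mod_cast (by lia : 0 < M)
  have hk0 : (0 : ℝ) < k := by exact_mod_cast hk
  have hk2 : (k : ℝ) < 2 * M := by exact_mod_cast hkM
  set a : ℝ := k * (Real.pi / M) with ha
  have hsin : Real.sin (a / 2) ≠ 0 := by
    refine (Real.sin_pos_of_pos_of_lt_pi (half_pos (mul_pos hk0 (div_pos Real.pi_pos hM))) ?_).ne'
    rw [mul_div_assoc', div_div, div_lt_iff₀ (by positivity)]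
    nlinarith [Real.pi_pos]
  have hsum := Real.sin_mul_sum_cos M a 0
  have hend : (M : ℝ) * a / 2 = k * Real.pi / 2 := by rw [ha]; field_simp
  have hmid : ((M : ℝ) - 1) * a / 2 + 0 = k * Real.pi / 2 - a / 2 := by rw [← hend]; ring
  have hdouble : 2 * (Real.sin (k * Real.pi / 2) * Real.cos (k * Real.pi / 2)) = 0 := by
    rw [← mul_assoc, ← Real.sin_two_mul, mul_div_cancel₀ _ two_ne_zero, Real.sin_nat_mul_pi]
  have hsq : 2 * Real.sin (k * Real.pi / 2) ^ 2 = 1 - (-1) ^ k := by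
    rw [Real.sin_sq_eq_half_sub, mul_div_cancel₀ _ two_ne_zero, Real.cos_nat_mul_pi]
    ring
  rw [hend, hmid, Real.cos_sub] at hsum
  refine mul_left_cancel₀ hsin ?_
  calc Real.sin (a / 2) * ∑ j ∈ Finset.range M, Real.cos (k * (Real.pi * j / M))
      = Real.sin (a / 2) * ∑ j ∈ Finset.range M, Real.cos (a * j + 0) := by
        refine congrArg _ (Finset.sum_congr rfl fun j _ => congrArg _ ?_)
        rw [ha]
        ring
    _ = Real.sin (a / 2) * ((1 - (-1) ^ k) / 2) := by
        linear_combination hsum + Real.cos (a / 2) / 2 * hdouble + Real.sin (a / 2) / 2 * hsq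

end General

namespace PlanarTree

section HeightSeries

open PowerSeries

/-- The generating series, by number of edges, of the ordered forests of height at most `h` that
can be grafted onto a vertex. -/
noncomputable def heightSeries : ℕ → PowerSeries ℝ
  | 0 => 1
  | h + 1 => (1 - X * heightSeries h)⁻¹

theorem heightSeries_succ_mul (h : ℕ) :
    heightSeries (h + 1) * (1 - X * heightSeries h) = 1 := by
  rw [heightSeries]
  exact PowerSeries.inv_mul_cancel _ (by simp)

/-- The affine image of `heightSeries` that turns its recursion into the addition formula of the
cotangent: at `X = (4 cos² θ)⁻¹` it equals `tan θ * cot ((h + 2) * θ)`. -/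
noncomputable def cotSeries (h : ℕ) : PowerSeries ℝ := 1 - 2 * X * heightSeries h

theorem cotSeries_succ_mul (h : ℕ) : (1 - cotSeries (h + 1)) * (1 + cotSeries h) = 4 * X := by
  rw [cotSeries, cotSeries]
  linear_combination 4 * X * heightSeries_succ_mul h

-- This is the derivative of `tan θ * cot ((h + 2) * θ)` with respect to `θ`.
theorem cotSeries_riccati (h : ℕ) :
    2 * X * (4 * X - 1) * derivative ℝ (cotSeries h) =
      4 * X * cotSeries h - ((h : PowerSeries ℝ) + 2) * (4 * X - 1 + cotSeries h ^ 2) := by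
  have hderiv4 : derivative ℝ (4 : PowerSeries ℝ) = 0 := by
    simpa using Derivation.map_natCast (derivative ℝ) 4
  have hderiv2 : derivative ℝ (2 : PowerSeries ℝ) = 0 := by
    simpa using Derivation.map_natCast (derivative ℝ) 2
  induction h with
  | zero =>
    have hderiv : derivative ℝ (cotSeries 0) = -2 := by
      simp [cotSeries, heightSeries, hderiv2]
    rw [hderiv, cotSeries, heightSeries]
    push_cast
    ring
  | succ h ih =>
    have hrec := cotSeries_succ_mul h
    have hderiv := congrArg (derivative ℝ) hrec
    simp only [Derivation.leibniz, map_sub, map_add, Derivation.map_one_eq_zero, smul_eq_mul,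
      derivative_X, hderiv4] at hderiv
    set a := cotSeries (h + 1)
    set b := cotSeries h
    have hne : (1 + b) ^ 2 ≠ 0 := by
      refine pow_ne_zero _ fun h0 => ?_
      have := congrArg constantCoeff h0
      simp [b, cotSeries] at this
    refine mul_right_cancel₀ hne ?_
    push_cast
    linear_combination (2 * X * (4 * X - 1)) * (-(1 + b) * hderiv + derivative ℝ b * hrec) +
      4 * X * ih + (4 * X * (1 + b) -
        ((h : PowerSeries ℝ) + 3) * (a * (1 + b) + (1 + b) - 4 * X)) * hrec

theorem cotSeries_pow_add_two (h k : ℕ) :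
    cotSeries h ^ (k + 2) = (1 - C 4 * X) * cotSeries h ^ k + C (1 / ((h : ℝ) + 2)) *
      (C 4 * (X * cotSeries h ^ (k + 1)) +
        C (2 / ((k : ℝ) + 1)) * (X * (1 - C 4 * X) * derivative ℝ (cotSeries h ^ (k + 1)))) := by
  have hriccati := cotSeries_riccati h
  have hC4 : (4 : PowerSeries ℝ) = C 4 := (map_ofNat C 4).symm
  have hCh : (C (1 / ((h : ℝ) + 2)) : PowerSeries ℝ) * ((h : PowerSeries ℝ) + 2) = 1 := by
    rw [show ((h : PowerSeries ℝ) + 2) = C ((h : ℝ) + 2) by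
      rw [map_add, map_natCast, map_ofNat], ← map_mul, one_div,
      inv_mul_cancel₀ (by positivity), map_one]
  have hCk : (C (2 / ((k : ℝ) + 1)) : PowerSeries ℝ) * ((k : PowerSeries ℝ) + 1) = 2 := by
    rw [show ((k : PowerSeries ℝ) + 1) = C ((k : ℝ) + 1) by simp, ← map_mul,
      div_mul_cancel₀ _ (by positivity), map_ofNat]
  rw [Derivation.leibniz_pow]
  simp only [Nat.add_sub_cancel, smul_eq_mul, nsmul_eq_mul]
  push_cast
  rw [hC4] at hriccati
  linear_combination (-(C (1 / ((h : ℝ) + 2)) * X * (1 - C 4 * X) * cotSeries h ^ k *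
      derivative ℝ (cotSeries h))) * hCk + C (1 / ((h : ℝ) + 2)) * cotSeries h ^ k * hriccati -
    cotSeries h ^ k * (C 4 * X - 1 + cotSeries h ^ 2) * hCh

end HeightSeries

section SpectralDecomposition

/-- The angles `π j / (h + 2)`, `1 ≤ j ≤ h + 1`, indexed from `0`: the cosines are half the
eigenvalues of the path with `h + 1` vertices. -/
noncomputable def angle (h j : ℕ) : ℝ := Real.pi * ((j : ℝ) + 1) / ((h : ℝ) + 2)

/-- The spectral form of the number of walks with `n` steps from the first to the `i`-th vertex
(counted from `1`) of the path with `h + 1` vertices. -/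
noncomputable def sineMoment (h i n : ℕ) : ℝ :=
  2 / ((h : ℝ) + 2) * ∑ j ∈ Finset.range (h + 1),
    Real.sin (angle h j) * Real.sin (i * angle h j) * (2 * Real.cos (angle h j)) ^ n

theorem sineMoment_zero_left (h n : ℕ) : sineMoment h 0 n = 0 := by simp [sineMoment]

theorem sineMoment_add_two_left (h n : ℕ) : sineMoment h (h + 2) n = 0 := by
  rw [sineMoment, Finset.sum_eq_zero, mul_zero]
  intro j _
  have hangle : ((h + 2 : ℕ) : ℝ) * angle h j = ((j + 1 : ℕ) : ℝ) * Real.pi := by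
    rw [angle]
    push_cast
    field_simp
  rw [hangle, Real.sin_nat_mul_pi, mul_zero, zero_mul]

theorem sineMoment_succ_succ (h i n : ℕ) :
    sineMoment h (i + 1) (n + 1) = sineMoment h i n + sineMoment h (i + 2) n := by
  rw [sineMoment, sineMoment, sineMoment, ← mul_add, ← Finset.sum_add_distrib]
  congr 1
  refine Finset.sum_congr rfl fun j _ => ?_
  have hprev : (i : ℝ) * angle h j = ((i + 1 : ℕ) : ℝ) * angle h j - angle h j := by
    push_cast; ring
  have hnext : ((i + 2 : ℕ) : ℝ) * angle h j = ((i + 1 : ℕ) : ℝ) * angle h j + angle h j := by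
    push_cast; ring
  rw [hprev, hnext, Real.sin_sub, Real.sin_add]
  ring

theorem sineMoment_succ_zero {h i : ℕ} (hi : i < h + 1) :
    sineMoment h (i + 1) 0 = if i = 0 then 1 else 0 := by
  have hcos : sineMoment h (i + 1) 0 = 1 / ((h : ℝ) + 2) *
      (∑ j ∈ Finset.range (h + 2), Real.cos (i * (Real.pi * j / ((h + 2 : ℕ) : ℝ))) -
        ∑ j ∈ Finset.range (h + 2),
          Real.cos ((i + 2 : ℕ) * (Real.pi * j / ((h + 2 : ℕ) : ℝ)))) := by
    rw [sineMoment, ← Finset.sum_sub_distrib, Finset.sum_range_succ' _ (h + 1)]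
    simp only [Nat.cast_zero, mul_zero, zero_div, Real.cos_zero, sub_self, add_zero]
    rw [div_eq_mul_one_div, mul_assoc, mul_left_comm, Finset.mul_sum]
    congr 1
    refine Finset.sum_congr rfl fun j _ => ?_
    have hprev : (i : ℝ) * (Real.pi * ((j + 1 : ℕ) : ℝ) / ((h + 2 : ℕ) : ℝ)) =
        ((i + 1 : ℕ) : ℝ) * angle h j - angle h j := by rw [angle]; push_cast; ring
    have hnext : ((i + 2 : ℕ) : ℝ) * (Real.pi * ((j + 1 : ℕ) : ℝ) / ((h + 2 : ℕ) : ℝ)) =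
        ((i + 1 : ℕ) : ℝ) * angle h j + angle h j := by rw [angle]; push_cast; ring
    rw [hprev, hnext, Real.cos_sub, Real.cos_add]
    ring
  rw [hcos, sum_cos_nat_mul_pi_div (k := i + 2) (by lia) (by lia)]
  split_ifs with h0
  · subst h0
    simp only [CharP.cast_eq_zero, zero_mul, Real.cos_zero, Finset.sum_const, Finset.card_range,
      nsmul_eq_mul, zero_add, even_two, Even.neg_pow, one_pow, sub_self, zero_div]
    push_cast
    field_simp
    ring
  · rw [sum_cos_nat_mul_pi_div (by lia) (by lia), pow_add, neg_one_sq, mul_one, sub_self, mul_zero]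

theorem sineMoment_eq_zero_of_lt {h n i : ℕ} (hi : i ≤ h + 2) (hn : n + 1 < i) :
    sineMoment h i n = 0 := by
  induction n generalizing i with
  | zero =>
    obtain ⟨i, rfl⟩ := Nat.exists_eq_succ_of_ne_zero (by lia : i ≠ 0)
    rcases Nat.lt_or_ge i (h + 1) with hlt | hge
    · rw [Nat.succ_eq_add_one, sineMoment_succ_zero hlt, if_neg (by lia)]
    · obtain rfl : i = h + 1 := by lia
      exact sineMoment_add_two_left h 0
  | succ n ih =>
    obtain ⟨i, rfl⟩ := Nat.exists_eq_succ_of_ne_zero (by lia : i ≠ 0)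
    rcases Nat.lt_or_ge i (h + 1) with hlt | hge
    · rw [Nat.succ_eq_add_one, sineMoment_succ_succ, ih (by lia) (by lia), ih (by lia) (by lia),
        add_zero]
    · obtain rfl : i = h + 1 := by lia
      exact sineMoment_add_two_left h _

open PowerSeries

/-- The generating series, by number of pairs of steps in excess of the minimum, of the walks from
the first to the `i`-th vertex (counted from `0`) of the path with `h + 1` vertices. -/
noncomputable def walkSeries (h i : ℕ) : PowerSeries ℝ :=
  PowerSeries.mk fun n => sineMoment h (i + 1) (2 * n + i)

theorem walkSeries_zero (h : ℕ) : walkSeries h 0 = 1 + X * walkSeries h 1 := by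
  ext n
  cases n with
  | zero => simpa [walkSeries] using sineMoment_succ_zero (h := h) (i := 0) (by lia)
  | succ n =>
    rw [map_add, coeff_succ_X_mul, coeff_one, if_neg (by lia), zero_add]
    simp only [walkSeries, coeff_mk]
    rw [show 2 * (n + 1) + 0 = (2 * n + 1) + 1 by ring, sineMoment_succ_succ,
      sineMoment_zero_left, zero_add]

theorem walkSeries_succ {h i : ℕ} (hi : i + 1 ≤ h) :
    walkSeries h (i + 1) = walkSeries h i + X * walkSeries h (i + 2) := by
  ext n
  rw [map_add]
  cases n with
  | zero =>
    simp only [walkSeries, coeff_mk, coeff_zero_X_mul]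
    rw [show 2 * 0 + (i + 1) = (2 * 0 + i) + 1 by ring, sineMoment_succ_succ,
      sineMoment_eq_zero_of_lt (i := i + 1 + 2) (by lia) (by lia)]
  | succ n =>
    rw [coeff_succ_X_mul]
    simp only [walkSeries, coeff_mk]
    rw [show 2 * (n + 1) + (i + 1) = (2 * (n + 1) + i) + 1 by ring, sineMoment_succ_succ]
    ring_nf

theorem walkSeries_add_one_right (h : ℕ) : walkSeries h (h + 1) = 0 := by
  ext n
  simp [walkSeries, sineMoment_add_two_left]

theorem walkSeries_succ_eq_mul {h d i : ℕ} (hd : i + 1 + d = h) :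
    walkSeries h (i + 1) = heightSeries d * walkSeries h i := by
  induction d generalizing i with
  | zero =>
    rw [walkSeries_succ (by lia)]
    obtain rfl : h = i + 1 := by lia
    rw [walkSeries_add_one_right, heightSeries, mul_zero, add_zero, one_mul]
  | succ d ih =>
    have hrec := walkSeries_succ (h := h) (i := i) (by lia)
    rw [ih (i := i + 1) (by lia)] at hrec
    linear_combination heightSeries (d + 1) * hrec -
      walkSeries h (i + 1) * heightSeries_succ_mul d

theorem walkSeries_zero_eq_heightSeries (h : ℕ) : walkSeries h 0 = heightSeries h := by
  have hrec := walkSeries_zero h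
  cases h with
  | zero => rw [hrec, walkSeries_add_one_right, heightSeries, mul_zero, add_zero]
  | succ h =>
    rw [walkSeries_succ_eq_mul (d := h) (by lia)] at hrec
    linear_combination heightSeries (h + 1) * hrec -
      walkSeries (h + 1) 0 * heightSeries_succ_mul h

theorem coeff_heightSeries (h n : ℕ) :
    coeff n (heightSeries h) = 2 * 4 ^ n * (1 / ((h : ℝ) + 2)) * ∑ j ∈ Finset.range (h + 1),
      Real.sin (angle h j) ^ 2 * (1 - Real.sin (angle h j) ^ 2) ^ n := by
  rw [← walkSeries_zero_eq_heightSeries, walkSeries, coeff_mk, sineMoment, Finset.mul_sum,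
    Finset.mul_sum]
  refine Finset.sum_congr rfl fun j _ => ?_
  rw [← Real.cos_sq', ← pow_mul, add_zero, zero_add, Nat.cast_one, one_mul, mul_pow,
    pow_mul (2 : ℝ)]
  ring

theorem coeff_succ_cotSeries (h n : ℕ) :
    coeff (n + 1) (cotSeries h) = -(4 ^ (n + 1) * (1 / ((h : ℝ) + 2))) *
      ∑ j ∈ Finset.range (h + 1),
        Real.sin (angle h j) ^ 2 * (1 - Real.sin (angle h j) ^ 2) ^ n := by
  rw [cotSeries, map_sub, mul_assoc, ← map_ofNat C, coeff_C_mul, coeff_succ_X_mul,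
    coeff_heightSeries, coeff_one, if_neg (by lia)]
  ring

/-- The polynomials in the spectral form of the coefficients of the powers of `cotSeries`: `x`
stands for the index of the coefficient, `s` for the squared sine of the angle and `v` for the
inverse of the length `h + 2`. -/
noncomputable def spectralPoly : ℕ → ℝ → ℝ → ℝ → ℝ
  | 0, _, _, _ => 0
  | 1, _, _, _ => 1
  | k + 2, x, s, v => (1 - s) ^ 2 * spectralPoly k x s v - (1 - s) * spectralPoly k (x - 1) s v +
      v * (spectralPoly (k + 1) (x - 1) s v + 2 / ((k : ℝ) + 1) *
        (x * (1 - s) * spectralPoly (k + 1) x s v -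
          (x - 1) * spectralPoly (k + 1) (x - 1) s v))

theorem coeff_cotSeries_pow {h k n : ℕ} (hn : 1 ≤ n) (hk : k ≤ n) :
    coeff n (cotSeries h ^ k) = -(4 ^ n * (1 / ((h : ℝ) + 2))) * ∑ j ∈ Finset.range (h + 1),
      Real.sin (angle h j) ^ 2 * (1 - Real.sin (angle h j) ^ 2) ^ (n - k) *
        spectralPoly k n (Real.sin (angle h j) ^ 2) (1 / ((h : ℝ) + 2)) := by
  obtain ⟨m, rfl⟩ := Nat.exists_eq_add_of_le' hn
  induction k using Nat.twoStepInduction generalizing m with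
  | zero => simp [spectralPoly, coeff_one]
  | one => simp [spectralPoly, coeff_succ_cotSeries]
  | more k ih0 ih1 =>
    obtain ⟨l, rfl⟩ : ∃ l, m = l + (k + 1) := ⟨m - (k + 1), by lia⟩
    have ih0' := ih0 (l + k) (by lia) (by lia)
    have ih1' := ih1 (l + k) (by lia) (by lia)
    rw [cotSeries_pow_add_two, map_add, coeff_C_mul, map_add, coeff_C_mul, coeff_C_mul,
      coeff_succ_X_mul_one_sub_mul_derivative, coeff_succ_X_mul, sub_mul, one_mul, map_sub,
      mul_assoc (C 4), coeff_C_mul, coeff_succ_X_mul, ih0 _ (by lia) (by lia),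
      ih1 _ (by lia) (by lia), ← add_assoc l k 1, ih0', ih1']
    simp only [Finset.mul_sum, ← Finset.sum_sub_distrib, ← Finset.sum_add_distrib]
    refine Finset.sum_congr rfl fun j _ => ?_
    rw [show l + k + 1 + 1 - k = l + 2 by lia, show l + k + 1 - k = l + 1 by lia,
      show l + k + 1 + 1 - (k + 1) = l + 1 by lia, show l + k + 1 - (k + 1) = l by lia,
      show l + k + 1 + 1 - (k + 2) = l by lia, spectralPoly]
    push_cast
    rw [add_sub_cancel_right]
    ring

end SpectralDecomposition

section SpectralPolynomials

theorem exists_eval_shift_eq (p : MvPolynomial (Fin 3) ℝ) :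
    ∃ q : MvPolynomial (Fin 3) ℝ, ∀ x s v : ℝ,
      p.eval ![(x - 1) * s * v, s, v] =
        p.eval ![x * s * v, s, v] - s * v * q.eval ![x * s * v, s, v] := by
  let shifted : Fin 3 → MvPolynomial (Fin 3) ℝ := ![.X 0 - .X 1 * .X 2, .X 1, .X 2]
  have hdvd : ∀ i, (.X 1 * .X 2 : MvPolynomial (Fin 3) ℝ) ∣ .X i - shifted i := by
    intro i
    fin_cases i <;> simp [shifted]
  obtain ⟨q, hq⟩ := dvd_aeval_sub_aeval hdvd p
  refine ⟨q, fun x s v => ?_⟩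
  have hshifted : (fun i => MvPolynomial.aeval ![x * s * v, s, v] (shifted i)) =
      ![(x - 1) * s * v, s, v] := by
    funext i
    fin_cases i
    · simp only [shifted, Fin.zero_eta, Matrix.cons_val_zero, map_sub, map_mul,
        MvPolynomial.aeval_X, Matrix.cons_val_one, Matrix.cons_val]
      ring
    · simp [shifted]
    · simp [shifted]
  have heval := congrArg (MvPolynomial.aeval ![x * s * v, s, v]) hq
  rw [map_sub, MvPolynomial.aeval_X_left_apply, MvPolynomial.comp_aeval_apply, hshifted] at heval
  simp only [map_mul, MvPolynomial.aeval_X, MvPolynomial.aeval_eq_eval, Matrix.cons_val_one,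
    Matrix.cons_val] at heval
  linear_combination -heval

theorem exists_spectralPoly_eq_eval (k : ℕ) :
    ∃ p : MvPolynomial (Fin 3) ℝ,
      (∀ x s v : ℝ, spectralPoly k x s v = MvPolynomial.eval ![x * s * v, s, v] p) ∧
      ∀ κ : ℝ, MvPolynomial.eval ![κ, 0, 0] p =
        if k = 0 then 0 else (-2 * κ) ^ (k - 1) / ((k - 1).factorial : ℝ) := by
  induction k using Nat.twoStepInduction with
  | zero => exact ⟨0, by simp [spectralPoly], by simp⟩
  | one => exact ⟨1, by simp [spectralPoly], by simp⟩
  | more k ih0 ih1 =>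
    obtain ⟨p, hp, -⟩ := ih0
    obtain ⟨q, hq, hq0⟩ := ih1
    obtain ⟨p', hp'⟩ := exists_eval_shift_eq p
    obtain ⟨q', hq'⟩ := exists_eval_shift_eq q
    let s : MvPolynomial (Fin 3) ℝ := .X 1
    let v : MvPolynomial (Fin 3) ℝ := .X 2
    refine ⟨(1 - s) ^ 2 * p - (1 - s) * (p - s * v * p') + v * (q - s * v * q') +
      .C (2 / ((k : ℝ) + 1)) * (.X 0 * (v * q' - q) + v * (q - s * v * q')), ?_, ?_⟩
    · intro x _ _
      rw [spectralPoly, hp, hp, hq, hq, hp', hq']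
      simp only [map_mul, map_add, map_sub, map_pow, map_one, MvPolynomial.eval_X,
        MvPolynomial.eval_C, s, v, Matrix.cons_val_one, Matrix.cons_val_zero, Matrix.cons_val]
      ring
    · intro κ
      have hk : (k.factorial : ℝ) ≠ 0 := by positivity
      simp only [map_mul, map_add, map_sub, map_pow, map_one, MvPolynomial.eval_X,
        MvPolynomial.eval_C, s, v, Matrix.cons_val_one, Matrix.cons_val_zero, Matrix.cons_val,
        hq0, Nat.add_eq_zero_iff, one_ne_zero, and_false, if_false, OfNat.ofNat_ne_zero,
        show k + 2 - 1 = k + 1 by lia, Nat.add_sub_cancel, Nat.factorial_succ]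
      push_cast
      field_simp
      ring

/-- The combination of the polynomials `spectralPoly i`, `i ≤ k`, that gives the coefficients of
`heightSeries h ^ k`. -/
noncomputable def heightPoly (k : ℕ) (x s v : ℝ) : ℝ :=
  2 ^ k * ∑ i ∈ Finset.range (k + 1),
    (k.choose i : ℝ) * (-1) ^ (i + 1) * (1 - s) ^ (k - i) * spectralPoly i x s v

open PowerSeries in
theorem coeff_heightSeries_pow {k : ℕ} (hk : 1 ≤ k) (h n : ℕ) :
    coeff n (heightSeries h ^ k) = 4 ^ n * (1 / ((h : ℝ) + 2)) * ∑ j ∈ Finset.range (h + 1),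
      Real.sin (angle h j) ^ 2 * (1 - Real.sin (angle h j) ^ 2) ^ n *
        heightPoly k (n + k) (Real.sin (angle h j) ^ 2) (1 / ((h : ℝ) + 2)) := by
  have hcot : X ^ k * (C (2 ^ k) * heightSeries h ^ k) = (1 - cotSeries h) ^ k := by
    rw [cotSeries, sub_sub_cancel, mul_pow, mul_pow, map_pow, map_ofNat]
    ring
  have hbinom : 2 ^ k * coeff n (heightSeries h ^ k) = ∑ i ∈ Finset.range (k + 1),
      (-1) ^ i * (k.choose i : ℝ) * coeff (n + k) (cotSeries h ^ i) := by
    rw [← coeff_C_mul, ← coeff_X_pow_mul _ k, hcot, sub_eq_neg_add, add_pow, map_sum]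
    refine Finset.sum_congr rfl fun i _ => ?_
    rw [← coeff_C_mul, neg_pow, one_pow, mul_one]
    congr 1
    simp only [map_mul, map_pow, map_neg, map_one, map_natCast]
    ring
  refine mul_left_cancel₀ (pow_ne_zero k (two_ne_zero' ℝ)) ?_
  simp only [hbinom, heightPoly, Finset.mul_sum]
  rw [Finset.sum_comm]
  refine Finset.sum_congr rfl fun i hi => ?_
  have hik : i ≤ k := Nat.lt_succ_iff.1 (Finset.mem_range.1 hi)
  rw [coeff_cotSeries_pow (by lia) (by lia), Finset.mul_sum, Finset.mul_sum]
  refine Finset.sum_congr rfl fun j _ => ?_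
  have hfour : (4 : ℝ) ^ k = 2 ^ k * 2 ^ k := by rw [← mul_pow]; norm_num
  rw [Nat.add_sub_assoc hik, pow_add, pow_add, hfour]
  push_cast
  ring

theorem exists_heightPoly_eq_eval (k : ℕ) :
    ∃ p : MvPolynomial (Fin 3) ℝ,
      (∀ x s v : ℝ, heightPoly k x s v = MvPolynomial.eval ![x * s * v, s, v] p) ∧
      ∀ κ : ℝ, MvPolynomial.eval ![κ, 0, 0] p =
        2 ^ k * ∑ i ∈ Finset.range k, (k.choose (i + 1) : ℝ) * (2 * κ) ^ i / (i.factorial : ℝ) := by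
  choose q hq hq0 using exists_spectralPoly_eq_eval
  refine ⟨.C (2 ^ k) * ∑ i ∈ Finset.range (k + 1),
    .C ((k.choose i : ℝ) * (-1) ^ (i + 1)) * (1 - .X 1) ^ (k - i) * q i, ?_, ?_⟩
  · intro x s v
    simp only [heightPoly, hq, map_mul, map_sum, map_sub, map_pow, map_one, MvPolynomial.eval_X,
      MvPolynomial.eval_C, Matrix.cons_val_one, Matrix.cons_val_zero]
  · intro κ
    simp only [map_mul, map_sum, map_sub, map_pow, map_one, MvPolynomial.eval_X,
      MvPolynomial.eval_C, Matrix.cons_val_one, Matrix.cons_val_zero, hq0]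
    rw [Finset.sum_range_succ']
    simp only [Nat.add_eq_zero_iff, one_ne_zero, and_false, if_false, if_true, mul_zero, add_zero,
      sub_zero, one_pow, mul_one, Nat.add_sub_cancel]
    refine congrArg _ (Finset.sum_congr rfl fun i _ => ?_)
    rw [show -2 * κ = -1 * (2 * κ) by ring, mul_pow, show i + 1 + 1 = i + 2 from rfl, pow_add,
      neg_one_sq]
    have hsign : (-1 : ℝ) ^ i * (-1) ^ i = 1 := pow_mul_pow_eq_one i (by norm_num)
    linear_combination ((k.choose (i + 1) : ℝ) * (2 * κ) ^ i / (i.factorial : ℝ)) * hsign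

end SpectralPolynomials

end PlanarTree

section General

theorem exists_norm_eval_le {σ R : Type*} [NormedCommRing R] (p : MvPolynomial σ R) :
    ∃ (C : ℝ) (d : ℕ), 0 ≤ C ∧ ∀ B : ℝ, 1 ≤ B → ∀ y : σ → R, (∀ i, ‖y i‖ ≤ B) →
      ‖MvPolynomial.eval y p‖ ≤ C * B ^ d := by
  induction p using MvPolynomial.induction_on with
  | C a => exact ⟨‖a‖, 0, norm_nonneg _, fun B _ y _ => by simp⟩
  | add p q hp hq =>
    obtain ⟨C, d, hC, hp⟩ := hp
    obtain ⟨D, e, hD, hq⟩ := hq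
    refine ⟨C + D, d + e, add_nonneg hC hD, fun B hB y hy => ?_⟩
    calc ‖MvPolynomial.eval y (p + q)‖ ≤ C * B ^ d + D * B ^ e := by
          rw [map_add]
          exact norm_add_le_of_le (hp B hB y hy) (hq B hB y hy)
      _ ≤ C * B ^ (d + e) + D * B ^ (d + e) := by gcongr <;> first | exact hB | lia
      _ = (C + D) * B ^ (d + e) := (add_mul ..).symm
  | mul_X p i hp =>
    obtain ⟨C, d, hC, hp⟩ := hp
    refine ⟨C, d + 1, hC, fun B hB y hy => ?_⟩
    rw [map_mul, MvPolynomial.eval_X, pow_succ, ← mul_assoc]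
    exact norm_mul_le_of_le (hp B hB y hy) (hy i)

theorem two_div_le_sin_pi_div {M : ℝ} (hM : 2 ≤ M) : 2 / M ≤ Real.sin (Real.pi / M) := by
  calc 2 / M = 2 / Real.pi * (Real.pi / M) := by field_simp
    _ ≤ Real.sin (Real.pi / M) := Real.mul_le_sin (by positivity) (by gcongr)

theorem exp_neg_le_one_sub_sin_pi_div_sq {M : ℝ} (hM : Real.pi < M) :
    Real.exp (-(Real.pi ^ 2 / (M ^ 2 - Real.pi ^ 2))) ≤ 1 - Real.sin (Real.pi / M) ^ 2 := by
  have hpi := Real.pi_pos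
  have hM0 : 0 < M := hpi.trans hM
  have hsq : 0 < M ^ 2 - Real.pi ^ 2 := sub_pos.2 (pow_lt_pow_left₀ hM hpi.le two_ne_zero)
  have hfrac : 1 - (Real.pi / M) ^ 2 = (M ^ 2 - Real.pi ^ 2) / M ^ 2 := by field_simp
  have hpos : 0 < 1 - (Real.pi / M) ^ 2 := hfrac ▸ div_pos hsq (pow_pos hM0 2)
  calc Real.exp (-(Real.pi ^ 2 / (M ^ 2 - Real.pi ^ 2)))
      = Real.exp (1 - (1 - (Real.pi / M) ^ 2)⁻¹) := by
        rw [hfrac]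
        congr 1
        field_simp
        ring
    _ ≤ 1 - (Real.pi / M) ^ 2 :=
        (Real.le_log_iff_exp_le hpos).1 (Real.one_sub_inv_le_log_of_pos hpos)
    _ ≤ 1 - Real.sin (Real.pi / M) ^ 2 := sub_le_sub_left Real.sin_sq_le_sq 1

theorem eventually_mul_pi_sq_le_sq_mul_sin_sq {c : ℝ} (hc : c < 1) :
    ∀ᶠ M : ℝ in atTop, c * Real.pi ^ 2 ≤ M ^ 2 * Real.sin (Real.pi / M) ^ 2 := by
  have hlim : Tendsto (fun M : ℝ => (Real.pi * Real.sinc (Real.pi / M)) ^ 2) atTop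
      (𝓝 ((Real.pi * Real.sinc 0) ^ 2)) :=
    ((Real.continuous_sinc.continuousAt.tendsto.comp
      (tendsto_const_nhds.div_atTop tendsto_id)).const_mul _).pow 2
  have hlt : c * Real.pi ^ 2 < (Real.pi * Real.sinc 0) ^ 2 := by
    rw [Real.sinc_zero, mul_one]
    exact mul_lt_of_lt_one_left (pow_pos Real.pi_pos 2) hc
  filter_upwards [hlim.eventually_const_le hlt, eventually_gt_atTop 0] with M hle hM
  have hne : Real.pi / M ≠ 0 := (div_pos Real.pi_pos hM).ne'
  refine hle.trans_eq ?_
  rw [Real.sinc_of_ne_zero hne]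
  field_simp

/-- The AM-GM inequality `27 κ² V ≤ (V + 2κ)³`, with a gain away from the equality case `V = κ`. -/
theorem mul_le_one_sub_sq_mul_add_cube {κ δ V : ℝ} (hκ : 0 < κ) (hδ : 0 < δ) (hV : 0 ≤ V)
    (hdist : δ ≤ |V - κ|) :
    27 * κ ^ 2 * V ≤ (1 - (δ / (3 * κ + δ)) ^ 2) * (V + 2 * κ) ^ 3 := by
  set ρ := δ / (3 * κ + δ) with hρ
  have hρ0 : 0 ≤ ρ := div_nonneg hδ.le (by linarith)
  have hlin : ρ * (V + 2 * κ) ≤ |V - κ| := by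
    rw [hρ, div_mul_eq_mul_div, div_le_iff₀ (by linarith)]
    rcases le_abs'.1 hdist with h | h
    · rw [abs_of_nonpos (by linarith)]
      nlinarith
    · rw [abs_of_nonneg (by linarith)]
      nlinarith
  have hsq : (ρ * (V + 2 * κ)) ^ 2 ≤ (V - κ) ^ 2 := by
    rw [← sq_abs (V - κ)]
    exact pow_le_pow_left₀ (mul_nonneg hρ0 (by linarith)) hlin 2
  have hcube : (ρ * (V + 2 * κ)) ^ 2 * (V + 2 * κ) ≤ (V - κ) ^ 2 * (V + 8 * κ) := by
    gcongr
    norm_num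
  linear_combination hcube

end General

namespace PlanarTree

section Modes

/-- The index set of the spectral decomposition of all the series `heightSeries h` together: the
pair `(h, j)` stands for the angle `angle h j`. -/
abbrev Mode := Σ h : ℕ, Fin (h + 1)

namespace Mode

/-- The denominator `h + 2` in the angle of a mode. -/
noncomputable def length (i : Mode) : ℝ := (i.1 : ℝ) + 2

/-- The squared sine of the angle of a mode. -/
noncomputable def sinSq (i : Mode) : ℝ := Real.sin (angle i.1 i.2) ^ 2

/-- The contribution of a mode to the sum over `h` of the coefficient of `4 ^ n * X ^ n` in
`exp (-μ * h) * heightSeries h`, up to a constant factor. -/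
noncomputable def weight (μ : ℝ) (n : ℕ) (i : Mode) : ℝ :=
  Real.exp (-μ * i.1) * (1 / i.length) * (i.sinSq * (1 - i.sinSq) ^ n)

/-- Up to a bounded term, minus the exponential rate of `weight`. -/
noncomputable def energy (μ : ℝ) (n : ℕ) (i : Mode) : ℝ := μ * i.length + n * i.sinSq

/-- The variables in which `heightPoly` is a polynomial; the weight concentrates on the modes for
which they are close to `(μ / 2, 0, 0)`. -/
noncomputable def coords (n : ℕ) (i : Mode) : Fin 3 → ℝ :=
  ![n * i.sinSq * (1 / i.length), i.sinSq, 1 / i.length]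

theorem two_le_length (i : Mode) : 2 ≤ i.length := le_add_of_nonneg_left (Nat.cast_nonneg _)

theorem length_pos (i : Mode) : 0 < i.length := two_pos.trans_le i.two_le_length

theorem one_div_length_le_one (i : Mode) : 1 / i.length ≤ 1 :=
  (div_le_one i.length_pos).2 (one_le_two.trans i.two_le_length)

theorem sinSq_nonneg (i : Mode) : 0 ≤ i.sinSq := sq_nonneg _

theorem sinSq_le_one (i : Mode) : i.sinSq ≤ 1 := Real.sin_sq_le_one _

theorem sin_pi_div_length_le (i : Mode) :
    Real.sin (Real.pi / i.length) ≤ Real.sin (angle i.1 i.2) := by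
  have hlength := i.length_pos
  have hpi := Real.pi_pos
  have hbase : Real.pi / i.length ≤ Real.pi / 2 := by
    gcongr
    exact i.two_le_length
  have hangle : angle i.1 i.2 = Real.pi * ((i.2 : ℝ) + 1) / i.length := rfl
  have hj : (i.2 : ℝ) + 1 ≤ i.length - 1 := by
    have hlt : ((i.2 : ℕ) : ℝ) + 1 ≤ (i.1 : ℝ) + 1 := mod_cast i.2.2
    rw [length]
    linarith
  have hge : Real.pi / i.length ≤ angle i.1 i.2 := by
    rw [hangle]
    gcongr
    exact le_mul_of_one_le_right hpi.le (le_add_of_nonneg_left (Nat.cast_nonneg _))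
  have hle : angle i.1 i.2 ≤ Real.pi - Real.pi / i.length := by
    rw [hangle, div_le_iff₀ hlength, sub_mul, div_mul_cancel₀ _ hlength.ne']
    nlinarith
  have hpos : 0 < Real.pi / i.length := div_pos hpi hlength
  rcases le_total (angle i.1 i.2) (Real.pi / 2) with h | h
  · exact Real.sin_le_sin_of_le_of_le_pi_div_two (by linarith) h hge
  · rw [← Real.sin_pi_sub (angle i.1 i.2)]
    exact Real.sin_le_sin_of_le_of_le_pi_div_two (by linarith) (by linarith) (by linarith)

theorem sin_pi_div_length_sq_le (i : Mode) : Real.sin (Real.pi / i.length) ^ 2 ≤ i.sinSq := by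
  refine pow_le_pow_left₀ ?_ i.sin_pi_div_length_le 2
  exact (div_pos two_pos i.length_pos).le.trans (two_div_le_sin_pi_div i.two_le_length)

theorem four_div_length_sq_le (i : Mode) : 4 / i.length ^ 2 ≤ i.sinSq :=
  calc 4 / i.length ^ 2 = (2 / i.length) ^ 2 := by rw [div_pow]; norm_num
    _ ≤ Real.sin (Real.pi / i.length) ^ 2 := pow_le_pow_left₀
        (div_pos two_pos i.length_pos).le (two_div_le_sin_pi_div i.two_le_length) 2
    _ ≤ i.sinSq := i.sin_pi_div_length_sq_le

theorem abs_coords_le (n : ℕ) (i : Mode) (t : Fin 3) : |coords n i t| ≤ n + 1 := by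
  have hn : (0 : ℝ) ≤ n := Nat.cast_nonneg n
  have hv : 0 ≤ 1 / i.length := (one_div_pos.2 i.length_pos).le
  fin_cases t
  · change |n * i.sinSq * (1 / i.length)| ≤ n + 1
    rw [abs_of_nonneg (mul_nonneg (mul_nonneg hn i.sinSq_nonneg) hv)]
    calc n * i.sinSq * (1 / i.length) ≤ n * 1 * 1 := by
          gcongr
          exacts [i.sinSq_le_one, i.one_div_length_le_one]
      _ ≤ n + 1 := by linarith
  · exact (abs_of_nonneg i.sinSq_nonneg).trans_le (i.sinSq_le_one.trans (by linarith))
  · exact (abs_of_nonneg hv).trans_le (i.one_div_length_le_one.trans (by linarith))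

theorem weight_nonneg (μ : ℝ) (n : ℕ) (i : Mode) : 0 ≤ i.weight μ n :=
  mul_nonneg (mul_nonneg (Real.exp_pos _).le (one_div_pos.2 i.length_pos).le)
    (mul_nonneg i.sinSq_nonneg (pow_nonneg (sub_nonneg.2 i.sinSq_le_one) n))

theorem weight_le (μ : ℝ) (n : ℕ) (i : Mode) :
    i.weight μ n ≤ Real.exp (2 * μ) * Real.exp (-i.energy μ n) := by
  have hpow : (1 - i.sinSq) ^ n ≤ Real.exp (-(n * i.sinSq)) := by
    rw [← mul_neg, Real.exp_nat_mul]
    exact pow_le_pow_left₀ (sub_nonneg.2 i.sinSq_le_one) (Real.one_sub_le_exp_neg _) n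
  calc i.weight μ n ≤ Real.exp (-μ * i.1) * 1 * (1 * Real.exp (-(n * i.sinSq))) := by
        rw [weight]
        gcongr
        exacts [mul_nonneg i.sinSq_nonneg (pow_nonneg (sub_nonneg.2 i.sinSq_le_one) n),
          i.one_div_length_le_one, pow_nonneg (sub_nonneg.2 i.sinSq_le_one) n, i.sinSq_le_one]
    _ = Real.exp (2 * μ) * Real.exp (-i.energy μ n) := by
        rw [mul_one, one_mul, ← Real.exp_add, ← Real.exp_add, energy, length]
        ring_nf

theorem mul_length_le_energy (μ : ℝ) (n : ℕ) (i : Mode) : μ * i.length ≤ i.energy μ n :=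
  le_add_of_nonneg_right (mul_nonneg (Nat.cast_nonneg n) i.sinSq_nonneg)

theorem summable_exp_neg_mul_length {τ : ℝ} (hτ : 0 < τ) :
    Summable fun i : Mode => Real.exp (-(τ * i.length)) := by
  rw [summable_sigma_of_nonneg fun i => (Real.exp_pos _).le]
  refine ⟨fun h => (hasSum_fintype _).summable, ?_⟩
  have hsum : Summable fun h : ℕ => (h : ℝ) ^ 1 * Real.exp (-τ * h) :=
    Real.summable_pow_mul_exp_neg_nat_mul 1 hτ
  refine (((summable_nat_add_iff 1).2 hsum).mul_left (Real.exp (-τ))).congr fun h => ?_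
  simp only [length, tsum_fintype, Finset.sum_const, Finset.card_univ, Fintype.card_fin,
    nsmul_eq_mul]
  rw [pow_one, mul_left_comm, ← Real.exp_add]
  push_cast
  ring_nf

theorem summable_weight {μ : ℝ} (hμ : 0 < μ) (n : ℕ) : Summable (weight μ n) := by
  refine Summable.of_nonneg_of_le (weight_nonneg μ n) (fun i => (weight_le μ n i).trans ?_)
    ((summable_exp_neg_mul_length hμ).mul_left (Real.exp (2 * μ)))
  gcongr
  exact mul_length_le_energy μ n i

end Mode

end Modes

section SaddlePoint

/-- The cube root of `n`, which is the order of magnitude of the heights that dominate the sums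
over modes. -/
noncomputable def heightScale (n : ℕ) : ℝ := (n : ℝ) ^ (((3 : ℕ) : ℝ)⁻¹)

theorem heightScale_nonneg (n : ℕ) : 0 ≤ heightScale n := Real.rpow_nonneg (Nat.cast_nonneg n) _

theorem heightScale_pow_three (n : ℕ) : heightScale n ^ 3 = n :=
  Real.rpow_inv_natCast_pow (Nat.cast_nonneg n) three_ne_zero

theorem tendsto_heightScale : Tendsto heightScale atTop atTop :=
  (tendsto_rpow_atTop (by norm_num)).comp tendsto_natCast_atTop_atTop

/-- The length, in units of `heightScale n`, of the modes of least energy: the minimiser of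
`M ↦ μ * M + π ^ 2 / M ^ 2`. -/
noncomputable def saddle (μ : ℝ) : ℝ := (Real.pi ^ 2 / (μ / 2)) ^ (((3 : ℕ) : ℝ)⁻¹)

theorem saddle_pos {μ : ℝ} (hμ : 0 < μ) : 0 < saddle μ :=
  Real.rpow_pos_of_pos (div_pos (pow_pos Real.pi_pos 2) (half_pos hμ)) _

theorem saddle_pow_three {μ : ℝ} (hμ : 0 < μ) : saddle μ ^ 3 = Real.pi ^ 2 / (μ / 2) :=
  Real.rpow_inv_natCast_pow (div_pos (pow_pos Real.pi_pos 2) (half_pos hμ)).le three_ne_zero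

/-- The least energy of a mode, in units of `heightScale n`: the minimum of
`M ↦ μ * M + π ^ 2 / M ^ 2`. -/
noncomputable def minEnergy (μ : ℝ) : ℝ := 3 * (μ / 2) * saddle μ

theorem minEnergy_pos {μ : ℝ} (hμ : 0 < μ) : 0 < minEnergy μ :=
  mul_pos (mul_pos three_pos (half_pos hμ)) (saddle_pos hμ)

theorem minEnergy_pow_three {μ : ℝ} (hμ : 0 < μ) :
    minEnergy μ ^ 3 = 27 * (μ / 2) ^ 2 * Real.pi ^ 2 := by
  rw [minEnergy, mul_pow, saddle_pow_three hμ]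
  field_simp
  norm_num

theorem mul_saddle_add_pi_sq_div_saddle_sq {μ : ℝ} (hμ : 0 < μ) :
    μ * saddle μ + Real.pi ^ 2 / saddle μ ^ 2 = minEnergy μ := by
  have hsaddle := saddle_pos hμ
  have hpi : Real.pi ^ 2 = saddle μ ^ 3 * (μ / 2) := by
    rw [saddle_pow_three hμ, div_mul_cancel₀ _ (half_pos hμ).ne']
  rw [minEnergy, hpi]
  field_simp
  ring

theorem minEnergy_pow_three_mul_le {μ δ c : ℝ} (hμ : 0 < μ) (hδ : 0 < δ) {n : ℕ} {i : Mode}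
    (hsin : c * Real.pi ^ 2 ≤ i.length ^ 2 * Real.sin (Real.pi / i.length) ^ 2)
    (hdist : δ ≤ |i.coords n 0 - μ / 2|) :
    c * minEnergy μ ^ 3 * n ≤ (1 - (δ / (3 * (μ / 2) + δ)) ^ 2) * i.energy μ n ^ 3 := by
  have hlength := i.length_pos
  have hcoord : i.length * i.coords n 0 = n * i.sinSq := by
    change i.length * (n * i.sinSq * (1 / i.length)) = _
    field_simp
  have henergy : i.length * (i.coords n 0 + 2 * (μ / 2)) = i.energy μ n := by
    rw [mul_add, hcoord, Mode.energy]
    ring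
  have hcoord_nonneg : 0 ≤ i.coords n 0 := by
    refine nonneg_of_mul_nonneg_right ?_ hlength
    exact hcoord ▸ mul_nonneg (Nat.cast_nonneg n) i.sinSq_nonneg
  have hle : c * Real.pi ^ 2 ≤ i.length ^ 2 * i.sinSq :=
    hsin.trans (mul_le_mul_of_nonneg_left i.sin_pi_div_length_sq_le (sq_nonneg _))
  calc c * minEnergy μ ^ 3 * n = 27 * (μ / 2) ^ 2 * n * (c * Real.pi ^ 2) := by
        rw [minEnergy_pow_three hμ]
        ring
    _ ≤ 27 * (μ / 2) ^ 2 * n * (i.length ^ 2 * i.sinSq) := by gcongr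
    _ = i.length ^ 3 * (27 * (μ / 2) ^ 2 * i.coords n 0) := by
        linear_combination -27 * (μ / 2) ^ 2 * i.length ^ 2 * hcoord
    _ ≤ i.length ^ 3 * ((1 - (δ / (3 * (μ / 2) + δ)) ^ 2) * (i.coords n 0 + 2 * (μ / 2)) ^ 3) :=
        mul_le_mul_of_nonneg_left (mul_le_one_sub_sq_mul_add_cube (half_pos hμ) hδ hcoord_nonneg
          hdist) (pow_pos hlength 3).le
    _ = (1 - (δ / (3 * (μ / 2) + δ)) ^ 2) * i.energy μ n ^ 3 := by
        rw [← henergy]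
        ring

theorem exists_energy_gap_of_length_ge {μ δ : ℝ} (hμ : 0 < μ) (hδ : 0 < δ) :
    ∃ η > 0, ∃ M > 0, ∀ (n : ℕ) (i : Mode), M ≤ i.length → δ ≤ |i.coords n 0 - μ / 2| →
      (minEnergy μ + η) * heightScale n ≤ i.energy μ n := by
  set ρ := δ / (3 * (μ / 2) + δ)
  have hden : 0 < 3 * (μ / 2) + δ := by linarith
  have hρ0 : 0 < ρ ^ 2 := pow_pos (div_pos hδ hden) 2
  have hρ1 : ρ ^ 2 < 1 :=
    pow_lt_one₀ (div_pos hδ hden).le ((div_lt_one hden).2 (by linarith)) two_ne_zero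
  obtain ⟨M, hM⟩ := eventually_atTop.1
    (eventually_mul_pi_sq_le_sq_mul_sin_sq (show 1 - ρ ^ 2 / 2 < 1 by linarith))
  obtain ⟨η, hη3, hη⟩ : ∃ η, (1 - ρ ^ 2) * (minEnergy μ + η) ^ 3 <
      (1 - ρ ^ 2 / 2) * minEnergy μ ^ 3 ∧ 0 < η := by
    have hcont : ContinuousAt (fun η : ℝ => (1 - ρ ^ 2) * (minEnergy μ + η) ^ 3) 0 := by fun_prop
    have hlt : (1 - ρ ^ 2) * (minEnergy μ + 0) ^ 3 < (1 - ρ ^ 2 / 2) * minEnergy μ ^ 3 := by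
      rw [add_zero]
      exact mul_lt_mul_of_pos_right (by linarith) (pow_pos (minEnergy_pos hμ) 3)
    exact ((hcont.mono_left nhdsWithin_le_nhds).eventually_lt_const hlt |>.and
      (eventually_mem_nhdsWithin (s := Set.Ioi 0))).exists
  refine ⟨η, hη, max M 1, lt_max_of_lt_right one_pos, fun n i hi hdist => ?_⟩
  have henergy : 0 ≤ i.energy μ n :=
    (mul_pos hμ i.length_pos).le.trans (i.mul_length_le_energy μ n)
  refine le_of_pow_le_pow_left₀ three_ne_zero henergy ?_
  refine le_of_mul_le_mul_left ?_ (sub_pos.2 hρ1)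
  calc (1 - ρ ^ 2) * ((minEnergy μ + η) * heightScale n) ^ 3
      = (1 - ρ ^ 2) * (minEnergy μ + η) ^ 3 * n := by
        rw [mul_pow, heightScale_pow_three, mul_assoc]
    _ ≤ (1 - ρ ^ 2 / 2) * minEnergy μ ^ 3 * n := by gcongr
    _ ≤ (1 - ρ ^ 2) * i.energy μ n ^ 3 :=
        minEnergy_pow_three_mul_le hμ hδ (hM _ (le_of_max_le_left hi)) hdist

theorem eventually_mul_heightScale_le_energy {μ B : ℝ} (hμ : 0 < μ) (hB : 0 < B) (c : ℝ) :
    ∀ᶠ n in atTop, ∀ i : Mode, B ≤ i.sinSq → c * heightScale n ≤ i.energy μ n := by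
  have hsq : Tendsto (fun n => heightScale n ^ 2 * B) atTop atTop :=
    ((tendsto_pow_atTop two_ne_zero).comp tendsto_heightScale).atTop_mul_const hB
  filter_upwards [hsq.eventually_ge_atTop c] with n hn i hi
  calc c * heightScale n ≤ heightScale n ^ 2 * B * heightScale n :=
        mul_le_mul_of_nonneg_right hn (heightScale_nonneg n)
    _ = n * B := by
        rw [← heightScale_pow_three]
        ring
    _ ≤ n * i.sinSq := mul_le_mul_of_nonneg_left hi (Nat.cast_nonneg n)
    _ ≤ i.energy μ n := le_add_of_nonneg_left (mul_pos hμ i.length_pos).le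

theorem exists_energy_gap {μ : ℝ} (hμ : 0 < μ) {U : Set (Fin 3 → ℝ)} (hU : U ∈ 𝓝 ![μ / 2, 0, 0]) :
    ∃ η > 0, ∀ᶠ n in atTop, ∀ i : Mode, i.coords n ∉ U →
      (minEnergy μ + η) * heightScale n ≤ i.energy μ n := by
  obtain ⟨δ, hδ, hball⟩ := Metric.mem_nhds_iff.1 hU
  obtain ⟨η, hη, M, hM, hgap⟩ := exists_energy_gap_of_length_ge hμ hδ
  refine ⟨η, hη, ?_⟩
  have hshort : 0 < 4 / M ^ 2 := div_pos four_pos (pow_pos hM 2)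
  have hcoarse : 0 < 4 / (1 / δ) ^ 2 := div_pos four_pos (pow_pos (one_div_pos.2 hδ) 2)
  filter_upwards [eventually_mul_heightScale_le_energy hμ hshort (minEnergy μ + η),
    eventually_mul_heightScale_le_energy hμ hcoarse (minEnergy μ + η),
    eventually_mul_heightScale_le_energy hμ hδ (minEnergy μ + η)] with n hshort hcoarse hlarge i hi
  have hsinSq_of_length_le : ∀ {L : ℝ}, i.length ≤ L → 4 / L ^ 2 ≤ i.sinSq := fun hL =>
    (div_le_div_of_nonneg_left four_pos.le (pow_pos i.length_pos 2)
      (pow_le_pow_left₀ i.length_pos.le hL 2)).trans i.four_div_length_sq_le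
  rcases le_total i.length M with hlength | hlength
  · exact hshort i (hsinSq_of_length_le hlength)
  have hfar : ∃ t, δ ≤ dist (i.coords n t) (![μ / 2, 0, 0] t) := by
    by_contra! hnear
    exact hi (hball ((dist_pi_lt_iff hδ).2 hnear))
  obtain ⟨t, ht⟩ := hfar
  fin_cases t
  · exact hgap n i hlength ht
  · refine hlarge i (ht.trans_eq ?_)
    exact (Real.dist_0_eq_abs _).trans (abs_of_nonneg i.sinSq_nonneg)
  · refine hcoarse i (hsinSq_of_length_le ?_)
    have hle : δ ≤ 1 / i.length := ht.trans_eq <|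
      (Real.dist_0_eq_abs _).trans (abs_of_nonneg (one_div_pos.2 i.length_pos).le)
    exact (le_one_div hδ i.length_pos).1 hle

theorem exists_tsum_indicator_weight_le {μ η : ℝ} (hμ : 0 < μ) (hη : 0 < η) :
    ∃ B, ∀ n : ℕ, ∑' i, {i : Mode | (minEnergy μ + η) * heightScale n ≤ i.energy μ n}.indicator
      (Mode.weight μ n) i ≤ B * Real.exp (-((minEnergy μ + η / 2) * heightScale n)) := by
  have hden : 0 < minEnergy μ + η := add_pos (minEnergy_pos hμ) hη
  set τ := η / 2 / (minEnergy μ + η) with hτ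
  have hτ0 : 0 < τ := div_pos (half_pos hη) hden
  have hτ1 : 0 ≤ 1 - τ := by
    rw [sub_nonneg, hτ, div_le_one hden]
    linarith [minEnergy_pos hμ]
  have hτ_mul : (1 - τ) * (minEnergy μ + η) = minEnergy μ + η / 2 := by
    rw [sub_mul, hτ, div_mul_cancel₀ _ hden.ne']
    ring
  let b : Mode → ℝ := fun i => Real.exp (2 * μ) * Real.exp (-(τ * μ * i.length))
  have hb : Summable b := (Mode.summable_exp_neg_mul_length (mul_pos hτ0 hμ)).mul_left _
  refine ⟨∑' i, b i, fun n => ?_⟩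
  rw [← tsum_mul_right]
  refine ((Mode.summable_weight hμ n).indicator _).tsum_le_tsum (fun i => ?_) (hb.mul_right _)
  refine Set.indicator_apply_le' (fun hi => (i.weight_le μ n).trans ?_) fun _ => by positivity
  rw [mul_assoc, ← Real.exp_add (-(τ * μ * i.length))]
  gcongr
  have hsplit : τ * (μ * i.length) + (1 - τ) * ((minEnergy μ + η) * heightScale n) ≤
      τ * i.energy μ n + (1 - τ) * i.energy μ n :=
    add_le_add (mul_le_mul_of_nonneg_left (i.mul_length_le_energy μ n) hτ0.le)
      (mul_le_mul_of_nonneg_left hi hτ1)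
  rw [← mul_assoc (1 - τ), hτ_mul] at hsplit
  linarith

end SaddlePoint

end PlanarTree

section General

theorem tendsto_tsum_mul_div_tsum {ι α : Type*} {u : Filter α} {w φ : α → ι → ℝ} {C : α → ℝ}
    {l : ℝ} (hw : ∀ n i, 0 ≤ w n i) (hsum : ∀ n, Summable (w n))
    (hpos : ∀ᶠ n in u, 0 < ∑' i, w n i) (hφ : ∀ n i, |φ n i - l| ≤ C n)
    (htail : ∀ ε > 0, Tendsto
      (fun n => C n * (∑' i, {i | ε < |φ n i - l|}.indicator (w n) i) / ∑' i, w n i) u (𝓝 0)) :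
    Tendsto (fun n => (∑' i, w n i * φ n i) / ∑' i, w n i) u (𝓝 l) := by
  rw [Metric.tendsto_nhds]
  intro ε hε
  filter_upwards [hpos, (htail (ε / 2) (half_pos hε)).eventually_lt_const (half_pos hε)]
    with n hZ hn
  set tail := {i | ε / 2 < |φ n i - l|}.indicator (w n)
  have htail_nonneg : ∀ i, 0 ≤ tail i := Set.indicator_nonneg fun i _ => hw n i
  have hterm : ∀ i, ‖w n i * (φ n i - l)‖ ≤ ε / 2 * w n i + C n * tail i := by
    intro i
    rw [norm_mul, Real.norm_of_nonneg (hw n i), Real.norm_eq_abs]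
    by_cases hi : ε / 2 < |φ n i - l|
    · rw [show tail i = w n i from if_pos hi, mul_comm (C n)]
      exact (mul_le_mul_of_nonneg_left (hφ n i) (hw n i)).trans
        (le_add_of_nonneg_left (mul_nonneg (half_pos hε).le (hw n i)))
    · rw [mul_comm (ε / 2)]
      exact (mul_le_mul_of_nonneg_left (not_lt.1 hi) (hw n i)).trans (le_add_of_nonneg_right
        (mul_nonneg ((abs_nonneg _).trans (hφ n i)) (htail_nonneg i)))
  have hbound : Summable fun i => ε / 2 * w n i + C n * tail i :=
    ((hsum n).mul_left _).add (((hsum n).indicator _).mul_left _)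
  have hcentre : ∑' i, w n i * φ n i = ∑' i, w n i * (φ n i - l) + l * ∑' i, w n i := by
    rw [← tsum_mul_left, ← (Summable.of_norm_bounded hbound hterm).tsum_add ((hsum n).mul_left _)]
    exact tsum_congr fun i => by ring
  have hle : |∑' i, w n i * (φ n i - l)| ≤ ε / 2 * ∑' i, w n i + C n * ∑' i, tail i := by
    rw [← tsum_mul_left, ← tsum_mul_left,
      ← ((hsum n).mul_left _).tsum_add (((hsum n).indicator _).mul_left _)]
    exact tsum_of_norm_bounded hbound.hasSum hterm
  rw [Real.dist_eq, hcentre, add_div, mul_div_cancel_right₀ _ hZ.ne', add_sub_cancel_right, abs_div,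
    abs_of_pos hZ, div_lt_iff₀ hZ]
  rw [div_lt_iff₀ hZ] at hn
  linarith

end General

namespace PlanarTree

section SaddlePoint

theorem exp_neg_le_weight_zero {μ : ℝ} (hμ : 0 < μ) {h : ℕ} (hh : Real.pi < (h : ℝ) + 2) (n : ℕ) :
    Real.exp (-(μ * ((h : ℝ) + 2) + 3 * Real.log ((h : ℝ) + 2) +
      n * (Real.pi ^ 2 / (((h : ℝ) + 2) ^ 2 - Real.pi ^ 2)))) ≤ Mode.weight μ n ⟨h, 0⟩ := by
  set i : Mode := ⟨h, 0⟩
  change Real.exp (-(μ * i.length + 3 * Real.log i.length +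
    n * (Real.pi ^ 2 / (i.length ^ 2 - Real.pi ^ 2)))) ≤ i.weight μ n
  have hlength := i.length_pos
  have hsinSq : i.sinSq = Real.sin (Real.pi / i.length) ^ 2 := by
    have hzero : ((i.2 : ℕ) : ℝ) = 0 := Nat.cast_zero
    rw [Mode.sinSq, angle, hzero, zero_add, mul_one, Mode.length]
  have hpow : Real.exp (-(n * (Real.pi ^ 2 / (i.length ^ 2 - Real.pi ^ 2)))) ≤
      (1 - i.sinSq) ^ n := by
    rw [← mul_neg, Real.exp_nat_mul, hsinSq]
    exact pow_le_pow_left₀ (Real.exp_pos _).le (exp_neg_le_one_sub_sin_pi_div_sq hh) n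
  have hprefactor : Real.exp (-(3 * Real.log i.length)) ≤ 1 / i.length * i.sinSq :=
    calc Real.exp (-(3 * Real.log i.length)) = 1 / i.length * (1 / i.length ^ 2) := by
          rw [Real.exp_neg, mul_comm, Real.exp_mul, Real.exp_log hlength]
          norm_num
          ring
      _ ≤ 1 / i.length * (4 / i.length ^ 2) := by
          gcongr
          norm_num
      _ ≤ 1 / i.length * i.sinSq :=
          mul_le_mul_of_nonneg_left i.four_div_length_sq_le (one_div_pos.2 hlength).le
  have hheight : Real.exp (-(μ * i.length)) ≤ Real.exp (-μ * i.1) := by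
    rw [neg_mul, Mode.length]
    gcongr
    linarith
  calc Real.exp (-(μ * i.length + 3 * Real.log i.length +
        n * (Real.pi ^ 2 / (i.length ^ 2 - Real.pi ^ 2))))
      = Real.exp (-(μ * i.length)) * Real.exp (-(3 * Real.log i.length)) *
        Real.exp (-(n * (Real.pi ^ 2 / (i.length ^ 2 - Real.pi ^ 2)))) := by
        rw [← Real.exp_add, ← Real.exp_add, neg_add, neg_add]
    _ ≤ Real.exp (-μ * i.1) * (1 / i.length * i.sinSq) * (1 - i.sinSq) ^ n := by
        gcongr
        exact mul_nonneg (Real.exp_pos _).le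
          (mul_nonneg (one_div_pos.2 hlength).le i.sinSq_nonneg)
    _ = i.weight μ n := by
        rw [Mode.weight]
        ring

theorem tendsto_ground_rate {μ : ℝ} (hμ : 0 < μ) {m : ℕ → ℝ} (hm : Tendsto m atTop atTop)
    (hratio : Tendsto (fun n => m n / heightScale n) atTop (𝓝 (saddle μ))) :
    Tendsto (fun n => (μ * m n + 3 * Real.log (m n) +
      n * (Real.pi ^ 2 / (m n ^ 2 - Real.pi ^ 2))) / heightScale n) atTop (𝓝 (minEnergy μ)) := by
  have hlog : Tendsto (fun n => Real.log (m n) / m n) atTop (𝓝 0) :=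
    Real.isLittleO_log_id_atTop.tendsto_div_nhds_zero.comp hm
  have hpi : Tendsto (fun n => Real.pi ^ 2 / heightScale n ^ 2) atTop (𝓝 0) :=
    tendsto_const_nhds.div_atTop ((tendsto_pow_atTop two_ne_zero).comp tendsto_heightScale)
  have hlast : Tendsto (fun n => Real.pi ^ 2 / ((m n / heightScale n) ^ 2 -
      Real.pi ^ 2 / heightScale n ^ 2)) atTop (𝓝 (Real.pi ^ 2 / (saddle μ ^ 2 - 0))) := by
    refine tendsto_const_nhds.div ((hratio.pow 2).sub hpi) ?_
    rw [sub_zero]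
    exact (pow_pos (saddle_pos hμ) 2).ne'
  have hlim := ((hratio.const_mul μ).add ((hlog.mul hratio).const_mul 3)).add hlast
  rw [zero_mul, mul_zero, add_zero, sub_zero, mul_saddle_add_pi_sq_div_saddle_sq hμ] at hlim
  refine hlim.congr' ?_
  filter_upwards [tendsto_heightScale.eventually_gt_atTop 0, hm.eventually_gt_atTop Real.pi]
    with n hscale hmn
  have hm0 : 0 < m n := Real.pi_pos.trans hmn
  have hsq : m n ^ 2 - Real.pi ^ 2 ≠ 0 :=
    (sub_pos.2 (pow_lt_pow_left₀ hmn Real.pi_pos.le two_ne_zero)).ne'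
  rw [← heightScale_pow_three n]
  field_simp

theorem eventually_exp_neg_le_tsum_weight {μ η : ℝ} (hμ : 0 < μ) (hη : 0 < η) :
    ∀ᶠ n in atTop, Real.exp (-((minEnergy μ + η) * heightScale n)) ≤
      ∑' i : Mode, i.weight μ n := by
  let m : ℕ → ℕ := fun n => ⌈saddle μ * heightScale n⌉₊
  have hm : Tendsto m atTop atTop :=
    tendsto_nat_ceil_atTop.comp (tendsto_heightScale.const_mul_atTop (saddle_pos hμ))
  have hrate := tendsto_ground_rate hμ (tendsto_natCast_atTop_atTop.comp hm)
    ((tendsto_nat_ceil_mul_div_atTop (saddle_pos hμ).le).comp tendsto_heightScale)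
  filter_upwards [hrate.eventually_lt_const (lt_add_of_pos_right _ hη),
    tendsto_heightScale.eventually_gt_atTop 0, hm.eventually_ge_atTop 4] with n hlt hscale hmn
  obtain ⟨h, hh⟩ : ∃ h, m n = h + 2 := ⟨m n - 2, by lia⟩
  have hcast : ((m n : ℕ) : ℝ) = (h : ℝ) + 2 := by
    rw [hh]
    push_cast
    rfl
  have hpi : Real.pi < (h : ℝ) + 2 := Real.pi_lt_four.trans_le (hcast ▸ mod_cast hmn)
  rw [Function.comp_apply, hcast, div_lt_iff₀ hscale] at hlt
  exact ((Real.exp_le_exp.2 (neg_le_neg hlt.le)).trans (exp_neg_le_weight_zero hμ hpi n)).trans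
    ((Mode.summable_weight hμ n).le_tsum _ fun i _ => i.weight_nonneg μ n)

theorem tendsto_mul_pow_mul_exp_neg_heightScale (C : ℝ) (d : ℕ) {a : ℝ} (ha : 0 < a) :
    Tendsto (fun n : ℕ => C * ((n : ℝ) + 1) ^ d * Real.exp (-(a * heightScale n))) atTop
      (𝓝 0) := by
  have hpoly : Tendsto (fun n : ℕ => ((n : ℝ) / (n + 1))⁻¹ ^ d) atTop (𝓝 (1⁻¹ ^ d)) :=
    ((tendsto_natCast_div_add_atTop 1).inv₀ one_ne_zero).pow d
  have hexp : Tendsto (fun y : ℝ => y ^ (3 * d) * Real.exp (-a * y)) atTop (𝓝 0) := by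
    simpa only [Real.rpow_natCast] using
      tendsto_rpow_mul_exp_neg_mul_atTop_nhds_zero ((3 * d : ℕ) : ℝ) a ha
  have hlim := (hpoly.mul (hexp.comp tendsto_heightScale)).const_mul C
  rw [mul_zero, mul_zero] at hlim
  refine hlim.congr' ?_
  filter_upwards [eventually_gt_atTop 0] with n hn
  have hn0 : (n : ℝ) ≠ 0 := Nat.cast_ne_zero.2 hn.ne'
  rw [Function.comp_apply, pow_mul, heightScale_pow_three, inv_div, neg_mul,
    ← mul_assoc (_ ^ d), ← mul_pow, div_mul_cancel₀ _ hn0, mul_assoc]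

theorem tendsto_mul_tsum_indicator_weight_div {μ : ℝ} (hμ : 0 < μ) {U : Set (Fin 3 → ℝ)}
    (hU : U ∈ 𝓝 ![μ / 2, 0, 0]) (C : ℝ) (d : ℕ) :
    Tendsto (fun n : ℕ => C * ((n : ℝ) + 1) ^ d *
      (∑' i, {i : Mode | i.coords n ∉ U}.indicator (Mode.weight μ n) i) /
        ∑' i : Mode, i.weight μ n) atTop (𝓝 0) := by
  obtain ⟨η, hη, hgap⟩ := exists_energy_gap hμ hU
  obtain ⟨B, hB⟩ := exists_tsum_indicator_weight_le hμ hη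
  have hquarter : 0 < η / 4 := by linarith
  refine squeeze_zero_norm' ?_ (tendsto_mul_pow_mul_exp_neg_heightScale (|C| * B) d hquarter)
  filter_upwards [hgap, eventually_exp_neg_le_tsum_weight hμ hquarter] with n hgap hlow
  have htail : ∑' i, {i : Mode | i.coords n ∉ U}.indicator (Mode.weight μ n) i ≤
      B * Real.exp (-((minEnergy μ + η / 2) * heightScale n)) :=
    (((Mode.summable_weight hμ n).indicator _).tsum_le_tsum (fun i =>
      Set.indicator_le_indicator_of_subset (fun i hi => hgap i hi) (Mode.weight_nonneg μ n) i)
      ((Mode.summable_weight hμ n).indicator _)).trans (hB n)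
  have htail_nonneg : 0 ≤ ∑' i, {i : Mode | i.coords n ∉ U}.indicator (Mode.weight μ n) i :=
    tsum_nonneg (Set.indicator_nonneg fun i _ => i.weight_nonneg μ n)
  have hZ : 0 < ∑' i : Mode, i.weight μ n := (Real.exp_pos _).trans_le hlow
  have hpow : 0 ≤ ((n : ℝ) + 1) ^ d := pow_nonneg (add_nonneg (Nat.cast_nonneg n) one_pos.le) d
  rw [norm_div, norm_mul, norm_mul, Real.norm_of_nonneg hZ.le, Real.norm_of_nonneg htail_nonneg,
    Real.norm_of_nonneg hpow, Real.norm_eq_abs, div_le_iff₀ hZ]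
  have hB0 : 0 ≤ B := nonneg_of_mul_nonneg_left (htail_nonneg.trans htail) (Real.exp_pos _)
  calc |C| * ((n : ℝ) + 1) ^ d *
        (∑' i, {i : Mode | i.coords n ∉ U}.indicator (Mode.weight μ n) i)
      ≤ |C| * ((n : ℝ) + 1) ^ d * (B * Real.exp (-((minEnergy μ + η / 2) * heightScale n))) := by
        gcongr
    _ = |C| * B * ((n : ℝ) + 1) ^ d * Real.exp (-(η / 4 * heightScale n)) *
          Real.exp (-((minEnergy μ + η / 4) * heightScale n)) := by
        rw [mul_assoc _ (Real.exp _) (Real.exp _), ← Real.exp_add]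
        ring_nf
    _ ≤ |C| * B * ((n : ℝ) + 1) ^ d * Real.exp (-(η / 4 * heightScale n)) *
          ∑' i : Mode, i.weight μ n := by gcongr

theorem exists_abs_eval_coords_le (p : MvPolynomial (Fin 3) ℝ) :
    ∃ (C : ℝ) (d : ℕ), ∀ (n : ℕ) (i : Mode),
      |MvPolynomial.eval (i.coords n) p| ≤ C * ((n : ℝ) + 1) ^ d := by
  obtain ⟨C, d, -, hCd⟩ := exists_norm_eval_le p
  exact ⟨C, d, fun n i => hCd _ (le_add_of_nonneg_left (Nat.cast_nonneg n)) _ (i.abs_coords_le n)⟩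

theorem summable_weight_mul_eval_coords {μ : ℝ} (hμ : 0 < μ) (p : MvPolynomial (Fin 3) ℝ) (n : ℕ) :
    Summable fun i : Mode => i.weight μ n * MvPolynomial.eval (i.coords n) p := by
  obtain ⟨C, d, hCd⟩ := exists_abs_eval_coords_le p
  refine Summable.of_norm_bounded ((Mode.summable_weight hμ n).mul_right (C * ((n : ℝ) + 1) ^ d))
    fun i => ?_
  rw [norm_mul, Real.norm_of_nonneg (i.weight_nonneg μ n)]
  exact mul_le_mul_of_nonneg_left (hCd n i) (i.weight_nonneg μ n)

theorem tendsto_tsum_weight_mul_eval_coords_div {μ : ℝ} (hμ : 0 < μ)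
    (p : MvPolynomial (Fin 3) ℝ) :
    Tendsto (fun n => (∑' i : Mode, i.weight μ n * MvPolynomial.eval (i.coords n) p) /
      ∑' i : Mode, i.weight μ n) atTop (𝓝 (MvPolynomial.eval ![μ / 2, 0, 0] p)) := by
  obtain ⟨C, d, hCd⟩ := exists_abs_eval_coords_le (p - .C (MvPolynomial.eval ![μ / 2, 0, 0] p))
  simp only [map_sub, MvPolynomial.eval_C] at hCd
  refine tendsto_tsum_mul_div_tsum (fun n i => i.weight_nonneg μ n) (Mode.summable_weight hμ) ?_ hCd
    fun ε hε => ?_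
  · filter_upwards [eventually_exp_neg_le_tsum_weight hμ one_pos] with n hn
    exact (Real.exp_pos _).trans_le hn
  · have hU : {y | |MvPolynomial.eval y p - MvPolynomial.eval ![μ / 2, 0, 0] p| ≤ ε} ∈
        𝓝 ![μ / 2, 0, 0] :=
      (MvPolynomial.continuous_eval p).continuousAt.preimage_mem_nhds
        (Metric.closedBall_mem_nhds _ hε)
    simpa only [Set.mem_ofPred_eq, not_le] using tendsto_mul_tsum_indicator_weight_div hμ hU C d

end SaddlePoint

section HeightSums

/-- The generating function at `exp (-μ)` over `h` of the numbers of forests with `k` roots, `n`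
edges and height at most `h`. -/
noncomputable def heightSum (μ : ℝ) (k n : ℕ) : ℝ :=
  ∑' h : ℕ, Real.exp (-μ * h) * PowerSeries.coeff n (heightSeries h ^ k)

/-- The limit as `n → ∞` of the ratio of `heightSum μ k n` to `heightSum μ 1 n`. -/
noncomputable def limitWeight (μ : ℝ) (k : ℕ) : ℝ :=
  2 ^ k * (∑ i ∈ Finset.range k, (k.choose (i + 1) : ℝ) * μ ^ i / (i.factorial : ℝ)) / 2

theorem limitWeight_one (μ : ℝ) : limitWeight μ 1 = 1 := by simp [limitWeight]

theorem exists_pow_mul_heightPoly_eq_eval_coords (μ : ℝ) (k a : ℕ) :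
    ∃ q : MvPolynomial (Fin 3) ℝ,
      (∀ (n : ℕ) (i : Mode), (1 - i.sinSq) ^ a * heightPoly k ((n + a : ℕ) + k) i.sinSq
        (1 / i.length) = MvPolynomial.eval (i.coords n) q) ∧
      MvPolynomial.eval ![μ / 2, 0, 0] q = 2 * limitWeight μ k := by
  obtain ⟨p, hp, hp0⟩ := exists_heightPoly_eq_eval k
  let shift : Fin 3 → MvPolynomial (Fin 3) ℝ :=
    ![.X 0 + .C ((a : ℝ) + k) * .X 1 * .X 2, .X 1, .X 2]
  have heval : ∀ x s v : ℝ,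
      MvPolynomial.eval ![x, s, v] ((1 - .X 1) ^ a * MvPolynomial.bind₁ shift p) =
        (1 - s) ^ a * MvPolynomial.eval ![x + (a + k) * s * v, s, v] p := by
    intro x s v
    have hshift : (fun i => MvPolynomial.eval ![x, s, v] (shift i)) =
        ![x + (a + k) * s * v, s, v] := by
      ext i
      fin_cases i <;> simp [shift]
    rw [map_mul, ← hshift]
    simp only [MvPolynomial.eval, MvPolynomial.eval₂Hom_bind₁]
    simp
  refine ⟨(1 - .X 1) ^ a * MvPolynomial.bind₁ shift p, fun n i => ?_, ?_⟩
  · rw [Mode.coords, heval, hp]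
    push_cast
    ring_nf
  · rw [heval, mul_zero, add_zero, hp0, mul_div_cancel₀ _ two_ne_zero, limitWeight,
      mul_div_cancel₀ _ two_ne_zero, sub_zero, one_pow, one_mul]

theorem exp_mul_coeff_heightSeries_pow {k a : ℕ} (hk : 1 ≤ k) {q : MvPolynomial (Fin 3) ℝ}
    (hq : ∀ (n : ℕ) (i : Mode), (1 - i.sinSq) ^ a * heightPoly k ((n + a : ℕ) + k) i.sinSq
      (1 / i.length) = MvPolynomial.eval (i.coords n) q) (μ : ℝ) (n h : ℕ) :
    Real.exp (-μ * h) * PowerSeries.coeff (n + a) (heightSeries h ^ k) =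
      4 ^ (n + a) * ∑' j : Fin (h + 1), Mode.weight μ n ⟨h, j⟩ *
        MvPolynomial.eval (Mode.coords n ⟨h, j⟩) q := by
  rw [coeff_heightSeries_pow hk, tsum_fintype, Finset.sum_range, Finset.mul_sum, Finset.mul_sum,
    Finset.mul_sum]
  refine Finset.sum_congr rfl fun j _ => ?_
  rw [← hq, Mode.weight, Mode.sinSq, Mode.length, pow_add _ n a]
  ring

theorem tendsto_heightSum_div_tsum_weight {μ : ℝ} (hμ : 0 < μ) {k : ℕ} (hk : 1 ≤ k) (a : ℕ) :
    Tendsto (fun n => heightSum μ k (n + a) / 4 ^ (n + a) / ∑' i : Mode, i.weight μ n) atTop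
      (𝓝 (2 * limitWeight μ k)) := by
  obtain ⟨q, hq, hq0⟩ := exists_pow_mul_heightPoly_eq_eval_coords μ k a
  rw [← hq0]
  refine (tendsto_tsum_weight_mul_eval_coords_div hμ q).congr fun n => ?_
  simp only [heightSum, exp_mul_coeff_heightSeries_pow hk hq, tsum_mul_left]
  rw [(summable_weight_mul_eval_coords hμ q n).tsum_sigma,
    mul_div_cancel_left₀ _ (pow_ne_zero _ four_ne_zero)]

theorem tendsto_heightSum_div_heightSum {μ : ℝ} (hμ : 0 < μ) {k : ℕ} (hk : 1 ≤ k) (a b : ℕ) :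
    Tendsto (fun n => heightSum μ k (n + a) / heightSum μ 1 (n + b)) atTop
      (𝓝 (4 ^ a / 4 ^ b * limitWeight μ k)) := by
  have hratio := (tendsto_heightSum_div_tsum_weight hμ hk a).div
    (tendsto_heightSum_div_tsum_weight hμ le_rfl b) (by simp [limitWeight_one])
  rw [limitWeight_one, mul_one, mul_div_cancel_left₀ _ two_ne_zero] at hratio
  refine (hratio.const_mul (4 ^ a / 4 ^ b)).congr' ?_
  filter_upwards [eventually_exp_neg_le_tsum_weight hμ one_pos] with n hn
  have hZ : ∑' i : Mode, i.weight μ n ≠ 0 := ((Real.exp_pos _).trans_le hn).ne'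
  rw [Pi.div_apply, div_div_div_cancel_right₀ hZ, pow_add, pow_add]
  field_simp

end HeightSums

end PlanarTree

section General

theorem bijective_orderHom_toSym (l k : ℕ) : Function.Bijective
    fun f : Fin l →o Fin k => (⟨(List.ofFn f : Multiset (Fin k)), by simp⟩ : Sym (Fin k) l) := by
  constructor
  · intro f g h
    have hperm : (List.ofFn f).Perm (List.ofFn g) := Multiset.coe_eq_coe.1 (congrArg Subtype.val h)
    exact DFunLike.coe_injective (List.ofFn_injective (hperm.eq_of_pairwise'
      f.monotone.sortedLE_ofFn.pairwise g.monotone.sortedLE_ofFn.pairwise))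
  · rintro ⟨⟨L⟩, rfl⟩
    refine ⟨⟨L.get ∘ Tuple.sort L.get, Tuple.monotone_sort L.get⟩, Subtype.ext ?_⟩
    exact (Multiset.coe_eq_coe.2 ((Tuple.sort L.get).ofFn_comp_perm L.get)).trans
      (congrArg _ (List.ofFn_get L))

noncomputable instance fintypeOrderHomFin (l k : ℕ) : Fintype (Fin l →o Fin k) :=
  have := Finite.of_injective _ (DFunLike.coe_injective (F := Fin l →o Fin k))
  Fintype.ofFinite _

theorem card_orderHom_fin (l k : ℕ) : Fintype.card (Fin l →o Fin k) = k.multichoose l := by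
  rw [Fintype.card_of_bijective (β := Sym (Fin k) l) (bijective_orderHom_toSym l k),
    Sym.card_sym_fin_eq_multichoose]

open PowerSeries in
-- This is `(1 - X * D)⁻ᵏ = ∑ l, k.multichoose l • (X * D) ^ l`; the factor `G` is there for the
-- induction.
theorem coeff_inv_one_sub_pow_mul {R : Type*} [CommRing R] {D E : PowerSeries R}
    (hE : E * (1 - X * D) = 1) (k n : ℕ) (G : PowerSeries R) :
    coeff n (E ^ k * G) =
      ∑ l ∈ Finset.range (n + 1), (k.multichoose l : R) * coeff (n - l) (D ^ l * G) := by
  induction k generalizing n G with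
  | zero => rw [Finset.sum_range_succ']; simp
  | succ k ihk =>
    have hrec : ∀ G, E ^ (k + 1) * G = E ^ k * G + X * (E ^ (k + 1) * (D * G)) := fun G => by
      linear_combination E ^ k * G * hE
    induction n generalizing G with
    | zero =>
      rw [hrec, map_add, ihk]
      simp
    | succ n ihn =>
      rw [hrec, map_add, ihk, coeff_succ_X_mul, ihn, Finset.sum_range_succ',
        Finset.sum_range_succ' _ (n + 1), add_right_comm, ← Finset.sum_add_distrib]
      simp only [Nat.multichoose_succ_succ, Nat.multichoose_zero_right, Nat.add_sub_add_right,
        Nat.cast_add, add_mul, pow_succ, mul_assoc]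

theorem hasSum_ite_le_geometric {x : ℝ} (hx : 0 ≤ x) (hx1 : x < 1) (a : ℕ) :
    HasSum (fun m => if a ≤ m then x ^ m else 0) (x ^ a / (1 - x)) := by
  refine ((add_left_injective a).hasSum_iff fun m hm => if_neg fun h => hm ⟨m - a, ?_⟩).1 ?_
  · exact Nat.sub_add_cancel h
  · rw [div_eq_mul_inv]
    refine ((hasSum_geometric_of_lt_one hx hx1).mul_left (x ^ a)).congr_fun fun m => ?_
    simp [pow_add, mul_comm]

end General

namespace PlanarTree

section Truncation

theorem levelCard_eq_zero_of_le (T : PlanarTree) {r s : ℕ} (hrs : r ≤ s)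
    (hr : T.levelCard r = 0) : T.levelCard s = 0 :=
  Nat.eq_zero_of_not_pos fun h => (T.levelCard_pos_of_le hrs h).ne' hr

theorem levelCard_ball (T : PlanarTree) {r s : ℕ} (hs : s ≤ r) :
    (T.ball r).levelCard s = T.levelCard s := if_pos (hs.trans (le_max_left r 1))

theorem parent_ball (T : PlanarTree) {r s : ℕ} (hs : s < r) (i : ℕ) :
    (T.ball r).parent s i = T.parent s i := if_pos (hs.trans_le (le_max_left r 1))

theorem ball_eq_self_iff (T : PlanarTree) {r : ℕ} (hr : 1 ≤ r) :
    T.ball r = T ↔ T.levelCard (r + 1) = 0 := by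
  have hlevel : ∀ s, r < s → (T.ball r).levelCard s = 0 := fun s hs => by
    simp only [ball, max_eq_left hr, if_neg hs.not_ge]
  refine ⟨fun h => h ▸ hlevel _ r.lt_succ_self, fun h => ?_⟩
  ext s i
  · rcases le_or_gt s r with hs | hs
    · exact T.levelCard_ball hs
    · rw [hlevel s hs, T.levelCard_eq_zero_of_le hs h]
  · rcases lt_or_ge s r with hs | hs
    · exact T.parent_ball hs i
    · rw [(T.ball r).parent_outside s i, T.parent_outside s i]
      · simp [T.levelCard_eq_zero_of_le (Nat.succ_le_succ hs) h]
      · simp [hlevel (s + 1) (Nat.lt_succ_of_le hs)]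

theorem ball_one_eq (T T' : PlanarTree) : T.ball 1 = T'.ball 1 := by
  obtain ⟨_, s, hs, h, -⟩ := agreement_nonempty T T'
  exact ball_eq_of_le hs h

theorem height_le_iff (T : PlanarTree) (m : ℕ) : T.height ≤ m ↔ T.levelCard (m + 1) = 0 := by
  rw [height, iSup₂_le_iff]
  refine ⟨fun h => by_contra fun hne => ?_, fun h r hr => ?_⟩
  · exact (Nat.cast_le.1 (h (m + 1) hne)).not_gt m.lt_succ_self
  · exact Nat.cast_le.2 (not_lt.1 fun hlt => hr (T.levelCard_eq_zero_of_le hlt h))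

theorem ball_eq_self_iff_height_le (T : PlanarTree) {r : ℕ} (hr : 1 ≤ r) :
    T.ball r = T ↔ T.height ≤ r := by
  rw [ball_eq_self_iff T hr, height_le_iff]

/-- The number of edges of `T` up to level `r`. -/
def edgesUpTo (T : PlanarTree) (r : ℕ) : ℕ := ∑ s ∈ Finset.range r, T.levelCard (s + 1)

theorem one_le_edgesUpTo (T : PlanarTree) {r : ℕ} (hr : 1 ≤ r) : 1 ≤ T.edgesUpTo r :=
  T.levelCard_one.ge.trans (Finset.single_le_sum (f := fun s => T.levelCard (s + 1))
    (fun _ _ => Nat.zero_le _) (Finset.mem_range.2 hr))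

theorem edgesUpTo_ball (T : PlanarTree) (r : ℕ) : (T.ball r).edgesUpTo r = T.edgesUpTo r :=
  Finset.sum_congr rfl fun _ hs => T.levelCard_ball (Finset.mem_range.1 hs)

theorem edgesUpTo_mono (T : PlanarTree) : Monotone T.edgesUpTo :=
  fun _ _ h => Finset.sum_le_sum_of_subset (Finset.range_mono h)

theorem size_eq_edgesUpTo {T : PlanarTree} {m : ℕ} (hm : T.height ≤ m) :
    T.size = (T.edgesUpTo m : ℕ∞) := by
  have hset : {p : ℕ × ℕ | p.2 < T.levelCard (p.1 + 1)} =
      (((Finset.range m).sigma fun s => Finset.range (T.levelCard (s + 1))).map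
        (Equiv.sigmaEquivProd ℕ ℕ).toEmbedding : Finset (ℕ × ℕ)) := by
    ext ⟨s, i⟩
    have hs : i < T.levelCard (s + 1) → s < m := fun hi => not_le.1 fun hms =>
      (Nat.zero_le i).not_gt (hi.trans_eq
        (T.levelCard_eq_zero_of_le (Nat.succ_le_succ hms) ((T.height_le_iff m).1 hm)))
    simpa using hs
  rw [size_eq, hset, Set.encard_coe_eq_coe_finsetCard, Finset.card_map, Finset.card_sigma]
  simp only [Finset.card_range, edgesUpTo]

end Truncation

section Extend

/-- The tree obtained from the first `r` levels of `T` by adding one more level, of `l` vertices,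
with parent map `f`. -/
def extend (T : PlanarTree) (r : ℕ) (hr : 1 ≤ r) {l : ℕ} (f : Fin l →o Fin (T.levelCard r)) :
    PlanarTree where
  levelCard s := if s ≤ r then T.levelCard s else if s = r + 1 then l else 0
  parent s i := if s < r then T.parent s i else if h : s = r ∧ i < l then f ⟨i, h.2⟩ else 0
  levelCard_zero := by simp [T.levelCard_zero]
  levelCard_one := by rw [if_pos hr, T.levelCard_one]
  parent_lt s i h := by
    have := T.parent_lt s i
    grind
  parent_mono s i j hij h := by
    have hlower := T.parent_mono s i j hij
    have htop (hj : j < l) : (f ⟨i, hij.trans_lt hj⟩ : ℕ) ≤ f ⟨j, hj⟩ := f.monotone hij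
    grind
  parent_outside s i h := by
    have := T.parent_outside s i
    grind

variable (T : PlanarTree) (r : ℕ) (hr : 1 ≤ r) {l : ℕ} (f : Fin l →o Fin (T.levelCard r))

theorem levelCard_extend_of_le {s : ℕ} (hs : s ≤ r) :
    (T.extend r hr f).levelCard s = T.levelCard s := if_pos hs

theorem levelCard_extend : (T.extend r hr f).levelCard (r + 1) = l := by simp [extend]

theorem parent_extend (i : Fin l) : (T.extend r hr f).parent r i = f i := by simp [extend]

theorem edgesUpTo_extend : (T.extend r hr f).edgesUpTo (r + 1) = T.edgesUpTo r + l := by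
  rw [edgesUpTo, Finset.sum_range_succ, levelCard_extend, edgesUpTo]
  exact congrArg (· + l) (Finset.sum_congr rfl fun s hs =>
    T.levelCard_extend_of_le r hr f (Finset.mem_range.1 hs))

theorem ball_succ_extend : (T.extend r hr f).ball (r + 1) = T.extend r hr f := by
  rw [ball_eq_self_iff _ (Nat.le_add_left 1 r)]
  simp [extend]

theorem ball_extend : (T.extend r hr f).ball r = T.ball r := by
  ext s i <;>
  · simp only [ball, extend, max_eq_left hr]
    split_ifs <;> rfl

theorem extend_injective :
    Function.Injective fun p : Σ l : ℕ, (Fin l →o Fin (T.levelCard r)) => T.extend r hr p.2 := by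
  rintro ⟨l, f⟩ ⟨l', f'⟩ h
  obtain rfl : l = l' := by
    rw [← T.levelCard_extend r hr f, ← T.levelCard_extend r hr f']
    exact congrFun (congrArg levelCard h) (r + 1)
  obtain rfl : f = f' := by
    ext i
    rw [← T.parent_extend r hr f, ← T.parent_extend r hr f']
    exact congrFun (congrFun (congrArg parent h) r) i
  rfl

theorem exists_extend_eq {S : PlanarTree} (hS : S.ball r = T) :
    ∃ f : Fin (S.levelCard (r + 1)) →o Fin (T.levelCard r), T.extend r hr f = S.ball (r + 1) := by
  have hlevel (s) (hs : s ≤ r) : T.levelCard s = S.levelCard s := by rw [← hS, S.levelCard_ball hs]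
  have hparent (s i) (hs : s < r) : T.parent s i = S.parent s i := by rw [← hS, S.parent_ball hs]
  let f : Fin (S.levelCard (r + 1)) →o Fin (T.levelCard r) :=
    ⟨fun i => ⟨S.parent r i, (S.parent_lt r i i.2).trans_eq (hlevel r le_rfl).symm⟩,
      fun i j hij => S.parent_mono r i j hij j.2⟩
  refine ⟨f, ?_⟩
  ext s i
  · simp only [extend, ball]
    grind
  · have houtside := S.parent_outside s i
    have hf (hi : i < S.levelCard (r + 1)) : (f ⟨i, hi⟩ : ℕ) = S.parent r i := rfl
    simp only [extend, ball]
    clear_value f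
    grind

end Extend

end PlanarTree

theorem one_sub_exp_neg_pos {μ : ℝ} (hμ : 0 < μ) : 0 < 1 - Real.exp (-μ) :=
  sub_pos.2 (Real.exp_lt_one_iff.2 (neg_lt_zero.2 hμ))

namespace PlanarTree

section Count

theorem height_le_of_mem_ofSize {N : ℕ} {T : PlanarTree} (hT : T ∈ ofSize N) : T.height ≤ N :=
  (T.height_le_iff N).2 (levelCard_eq_zero_of_mem hT N.lt_succ_self)

theorem edgesUpTo_le_of_mem_ofSize {N : ℕ} {T : PlanarTree} (hT : T ∈ ofSize N) (r : ℕ) :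
    T.edgesUpTo r ≤ N := by
  have hheight : T.height ≤ (max N r : ℕ) :=
    (height_le_of_mem_ofSize hT).trans (Nat.cast_le.2 (le_max_left N r))
  have hsize : ((T.edgesUpTo (max N r) : ℕ) : ℕ∞) = N := (size_eq_edgesUpTo hheight).symm.trans hT
  exact (T.edgesUpTo_mono (le_max_right N r)).trans_eq (Nat.cast_inj.1 hsize)

open Classical in
/-- The trees of size `N` whose ball of radius `r` is `T`. -/
noncomputable def sizedCylinder (N : ℕ) (T : PlanarTree) (r : ℕ) : Finset PlanarTree :=
  {S ∈ (finite_ofSize N).toFinset | S.ball r = T}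

theorem mem_sizedCylinder {N r : ℕ} {S T : PlanarTree} :
    S ∈ sizedCylinder N T r ↔ S ∈ ofSize N ∧ S.ball r = T := by
  simp only [sizedCylinder, Finset.mem_filter, Set.Finite.mem_toFinset]

theorem sizedCylinder_disjoint (N r : ℕ) {T T' : PlanarTree} (h : T ≠ T') :
    Disjoint (sizedCylinder N T r) (sizedCylinder N T' r) :=
  Finset.disjoint_left.2 fun _ hS hS' =>
    h ((mem_sizedCylinder.1 hS).2.symm.trans (mem_sizedCylinder.1 hS').2)

open Classical in
theorem sizedCylinder_eq_biUnion {T : PlanarTree} {r : ℕ} (hr : 1 ≤ r) (hT : T.ball r = T)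
    (n : ℕ) :
    sizedCylinder (T.edgesUpTo r + n) T r =
      Finset.univ.biUnion fun p : Σ l : Fin (n + 1), Fin l →o Fin (T.levelCard r) =>
        sizedCylinder (T.edgesUpTo r + n) (T.extend r hr p.2) (r + 1) := by
  ext S
  simp only [Finset.mem_biUnion, Finset.mem_univ, true_and, mem_sizedCylinder, exists_and_left]
  refine and_congr_right fun hS => ⟨fun hball => ?_, fun ⟨p, hp⟩ => ?_⟩
  · obtain ⟨f, hf⟩ := exists_extend_eq T r hr hball
    have hedges := edgesUpTo_le_of_mem_ofSize hS (r + 1)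
    rw [← edgesUpTo_ball, ← hf, edgesUpTo_extend] at hedges
    exact ⟨⟨⟨_, by lia⟩, f⟩, hf.symm⟩
  · rw [← S.ball_ball r.le_succ, hp, ball_extend, hT]

open Classical in
theorem sizedCylinder_height_le_self {T : PlanarTree} {r : ℕ} (hr : 1 ≤ r) (hT : T.ball r = T)
    (n : ℕ) :
    {S ∈ sizedCylinder (T.edgesUpTo r + n) T r | S.height ≤ (r : ℕ∞)} =
      if n = 0 then {T} else ∅ := by
  have hheight : T.height ≤ r := (ball_eq_self_iff_height_le T hr).1 hT
  ext S
  have hS : S ∈ sizedCylinder (T.edgesUpTo r + n) T r ∧ S.height ≤ r ↔ n = 0 ∧ S = T := by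
    rw [mem_sizedCylinder, and_assoc, ← ball_eq_self_iff_height_le S hr]
    refine ⟨fun ⟨hsize, hball, hself⟩ => ?_, fun ⟨hn, hST⟩ => ?_⟩
    · obtain rfl : T = S := hball.symm.trans hself
      have hn : T.edgesUpTo r = T.edgesUpTo r + n :=
        Nat.cast_inj.1 ((size_eq_edgesUpTo hheight).symm.trans hsize)
      exact ⟨by lia, rfl⟩
    · rw [hn, hST]
      exact ⟨size_eq_edgesUpTo hheight, hT, hT⟩
  rw [Finset.mem_filter, hS]
  split_ifs with hn <;> simp [hn]

open Classical PowerSeries in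
theorem card_sizedCylinder_height_le {T : PlanarTree} {r : ℕ} (hr : 1 ≤ r) (hT : T.ball r = T)
    (n h : ℕ) :
    (Finset.card {S ∈ sizedCylinder (T.edgesUpTo r + n) T r | S.height ≤ ((r + h : ℕ) : ℕ∞)} : ℝ) =
      coeff n (heightSeries h ^ T.levelCard r) := by
  induction h generalizing T r n with
  | zero =>
    rw [add_zero, sizedCylinder_height_le_self hr hT, heightSeries, one_pow, coeff_one]
    split_ifs <;> simp
  | succ h ih =>
    have hcard (l : Fin (n + 1)) (f : Fin l →o Fin (T.levelCard r)) :
        (Finset.card {S ∈ sizedCylinder (T.edgesUpTo r + n) (T.extend r hr f) (r + 1) |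
          S.height ≤ ((r + (h + 1) : ℕ) : ℕ∞)} : ℝ) = coeff (n - l) (heightSeries h ^ (l : ℕ)) := by
      have hedges : T.edgesUpTo r + n = (T.extend r hr f).edgesUpTo (r + 1) + (n - l) := by
        rw [edgesUpTo_extend]
        lia
      rw [hedges, Nat.add_comm h, ← Nat.add_assoc,
        ih (Nat.le_add_left 1 r) (ball_succ_extend ..), levelCard_extend]
    have hseries := coeff_inv_one_sub_pow_mul (heightSeries_succ_mul h) (T.levelCard r) n 1
    simp only [mul_one] at hseries
    rw [hseries, sizedCylinder_eq_biUnion hr hT, Finset.filter_biUnion, Finset.card_biUnion,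
      Nat.cast_sum, Fintype.sum_sigma, Finset.sum_range]
    · simp only [hcard, Finset.sum_const, Finset.card_univ, card_orderHom_fin, nsmul_eq_mul]
    · rintro ⟨⟨l, hl⟩, f⟩ - ⟨⟨l', hl'⟩, f'⟩ - hne
      refine (sizedCylinder_disjoint _ _ fun heq => hne ?_).mono (Finset.filter_subset _ _)
        (Finset.filter_subset _ _)
      cases T.extend_injective r hr (a₁ := ⟨l, f⟩) (a₂ := ⟨l', f'⟩) heq
      rfl

end Count

section Cylinder

theorem hasSum_weight {μ : ℝ} (hμ : 0 < μ) {T : PlanarTree} (hT : T.height ≠ ⊤) :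
    HasSum (fun m : ℕ => if T.height ≤ m then Real.exp (-μ) ^ m else 0)
      (weight μ T / (1 - Real.exp (-μ))) := by
  obtain ⟨a, ha⟩ := ENat.ne_top_iff_exists.1 hT
  have hgeom := hasSum_ite_le_geometric (Real.exp_nonneg (-μ))
    (Real.exp_lt_one_iff.2 (neg_lt_zero.2 hμ)) a
  simpa only [weight, ← ha, Nat.cast_le, ENat.toNat_natCast, mul_comm (-μ), Real.exp_nat_mul]
    using hgeom

/-- The total weight of the trees of size `N` whose ball of radius `r` is `T`. -/
noncomputable def cylinderWeight (μ : ℝ) (N : ℕ) (T : PlanarTree) (r : ℕ) : ℝ :=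
  ∑ S ∈ sizedCylinder N T r, weight μ S

open Classical in
theorem hasSum_cylinderWeight {μ : ℝ} (hμ : 0 < μ) (N : ℕ) (T : PlanarTree) (r : ℕ) :
    HasSum (fun m : ℕ => Real.exp (-μ) ^ m *
      (Finset.card {S ∈ sizedCylinder N T r | S.height ≤ (m : ℕ∞)} : ℝ))
      (cylinderWeight μ N T r / (1 - Real.exp (-μ))) := by
  have hfinite : ∀ S ∈ sizedCylinder N T r, S.height ≠ ⊤ := fun S hS =>
    ne_top_of_le_ne_top (ENat.natCast_ne_top N) (height_le_of_mem_ofSize (mem_sizedCylinder.1 hS).1)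
  rw [cylinderWeight, Finset.sum_div]
  refine (hasSum_sum fun S hS => hasSum_weight hμ (hfinite S hS)).congr_fun fun m => ?_
  rw [← Finset.sum_filter, Finset.sum_const, nsmul_eq_mul, mul_comm]

theorem levelCard_eq_of_ball_eq {S T : PlanarTree} {r : ℕ} (h : S.ball r = T) :
    S.levelCard r = T.levelCard r := by
  rw [← h, S.levelCard_ball le_rfl]

theorem cylinderWeight_edgesUpTo_add {μ : ℝ} (hμ : 0 < μ) {T : PlanarTree} {r : ℕ} (hr : 1 ≤ r)
    (hT : T.ball r = T) (hpos : T.levelCard r ≠ 0) (n : ℕ) :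
    cylinderWeight μ (T.edgesUpTo r + n) T r =
      (1 - Real.exp (-μ)) * Real.exp (-μ) ^ r * heightSum μ (T.levelCard r) n := by
  classical
  have hlow : ∀ m ∉ Set.range (r + ·), Real.exp (-μ) ^ m * (Finset.card
      {S ∈ sizedCylinder (T.edgesUpTo r + n) T r | S.height ≤ (m : ℕ∞)} : ℝ) = 0 := by
    intro m hm
    have hmr : m < r := not_le.1 fun h => hm ⟨m - r, Nat.add_sub_cancel' h⟩
    rw [Finset.filter_false_of_mem, Finset.card_empty, Nat.cast_zero, mul_zero]
    intro S hS hheight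
    rw [← levelCard_eq_of_ball_eq (mem_sizedCylinder.1 hS).2] at hpos
    exact hpos (S.levelCard_eq_zero_of_le hmr ((S.height_le_iff m).1 hheight))
  have hsum := (((add_right_injective r).hasSum_iff hlow).2
    (hasSum_cylinderWeight hμ (T.edgesUpTo r + n) T r)).tsum_eq
  simp only [Function.comp_apply, card_sizedCylinder_height_le hr hT, pow_add, mul_assoc,
    tsum_mul_left] at hsum
  rw [← (eq_div_iff (one_sub_exp_neg_pos hμ).ne').1 hsum, heightSum]
  simp only [mul_comm (-μ), Real.exp_nat_mul]
  ring

theorem cylinderWeight_eq_zero (μ : ℝ) {T : PlanarTree} {r N : ℕ} (hzero : T.levelCard r = 0)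
    (hN : T.edgesUpTo r < N) : cylinderWeight μ N T r = 0 := by
  refine Finset.sum_eq_zero fun S hS => absurd hN ?_
  obtain ⟨hsize, hball⟩ := mem_sizedCylinder.1 hS
  have hheight : S.height ≤ r := (S.height_le_iff r).2
    (S.levelCard_eq_zero_of_le r.le_succ ((levelCard_eq_of_ball_eq hball).trans hzero))
  rw [← hball, edgesUpTo_ball, Nat.cast_inj.1 ((size_eq_edgesUpTo hheight).symm.trans hsize)]
  exact lt_irrefl N

theorem partitionFunction_add_one {μ : ℝ} (hμ : 0 < μ) (n : ℕ) :
    partitionFunction μ (n + 1) =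
      (1 - Real.exp (-μ)) * Real.exp (-μ) * heightSum μ 1 n := by
  have hpath : (path 1).ball 1 = path 1 := (ball_eq_self_iff _ le_rfl).2 (by simp [path])
  have hedges : (path 1).edgesUpTo 1 = 1 := by simp [edgesUpTo, levelCard_one]
  have hcylinder := cylinderWeight_edgesUpTo_add hμ le_rfl hpath
    ((levelCard_one _).trans_ne one_ne_zero) n
  rw [levelCard_one, hedges, pow_one, add_comm] at hcylinder
  rw [← hcylinder, partitionFunction, cylinderWeight]
  congr 1
  ext T
  simp [mem_sizedCylinder, (T.ball_one_eq _).trans hpath]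

/-- The limit as `N → ∞` of the probability that a tree of size `N` has the ball of radius `r`
around the root equal to `T`. -/
noncomputable def cylinderLimit (μ : ℝ) (T : PlanarTree) (r : ℕ) : ℝ :=
  Real.exp (-μ) ^ (r - 1) * (1 / 4) ^ (T.edgesUpTo r - 1) * limitWeight μ (T.levelCard r)

theorem tendsto_cylinderWeight_div {μ : ℝ} (hμ : 0 < μ) {T : PlanarTree} {r : ℕ} (hr : 1 ≤ r)
    (hT : T.ball r = T) :
    Tendsto (fun N => cylinderWeight μ N T r / partitionFunction μ N) atTop
      (𝓝 (cylinderLimit μ T r)) := by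
  by_cases hpos : T.levelCard r = 0
  · rw [cylinderLimit, hpos, limitWeight]
    simp only [Finset.range_zero, Finset.sum_empty, mul_zero, zero_div]
    refine tendsto_const_nhds.congr' ?_
    filter_upwards [eventually_gt_atTop (T.edgesUpTo r)] with N hN
    rw [cylinderWeight_eq_zero μ hpos hN, zero_div]
  · obtain ⟨e, he⟩ := Nat.exists_eq_add_of_le' (T.one_le_edgesUpTo hr)
    obtain ⟨s, rfl⟩ := Nat.exists_eq_add_of_le' hr
    have hlim := (tendsto_heightSum_div_heightSum hμ (Nat.one_le_iff_ne_zero.2 hpos) 0 e).const_mul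
      (Real.exp (-μ) ^ s)
    rw [cylinderLimit, he, ← tendsto_add_atTop_iff_nat (e + 1)]
    convert hlim using 2 with n
    · rw [add_comm n, ← he, cylinderWeight_edgesUpTo_add hμ hr hT hpos, he, add_right_comm,
        partitionFunction_add_one hμ, pow_succ]
      have hexp := Real.exp_ne_zero (-μ)
      have hgeom := (one_sub_exp_neg_pos hμ).ne'
      rw [add_zero, add_comm e, Nat.add_comm n]
      field_simp
    · simp only [Nat.add_sub_cancel, one_div, inv_pow, pow_zero, mul_assoc]

end Cylinder

end PlanarTree

section Binomial

theorem tsum_multichoose_mul_inv_two_pow (d : ℕ) :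
    ∑' m : ℕ, (d.multichoose m : ℝ≥0∞) * 2⁻¹ ^ m = 2 ^ d := by
  cases d with
  | zero =>
    rw [tsum_eq_single 0 fun m hm => ?_]
    · simp
    · obtain ⟨m, rfl⟩ := Nat.exists_eq_succ_of_ne_zero hm
      simp
  | succ d =>
    have hgeom : HasSum (fun m : ℕ => ((m + d).choose d : ℝ) * 2⁻¹ ^ m) (2 ^ (d + 1)) := by
      have hinv : 1 / (1 - 2⁻¹) ^ (d + 1) = (2 : ℝ) ^ (d + 1) := by
        rw [one_div, ← inv_pow]
        norm_num
      exact hinv ▸ hasSum_choose_mul_geometric_of_norm_lt_one d (by norm_num)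
    have hofReal := ENNReal.ofReal_tsum_of_nonneg (fun m => by positivity) hgeom.summable
    rw [hgeom.tsum_eq, ENNReal.ofReal_pow zero_le_two, ENNReal.ofReal_ofNat] at hofReal
    rw [hofReal]
    refine tsum_congr fun m => ?_
    rw [ENNReal.ofReal_mul (Nat.cast_nonneg _), ENNReal.ofReal_natCast,
      ENNReal.ofReal_pow (by positivity), ENNReal.ofReal_inv_of_pos two_pos, ENNReal.ofReal_ofNat,
      Nat.multichoose_eq, Nat.add_right_comm, Nat.add_sub_cancel, add_comm d, Nat.choose_symm_add]

theorem multichoose_mul_choose (k j m : ℕ) :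
    k.multichoose (j + m) * (j + m).choose j = k.multichoose j * (k + j).multichoose m := by
  rcases k with - | k
  · rcases j with - | j <;> simp [add_right_comm _ 1]
  · rw [Nat.multichoose_eq, Nat.multichoose_eq, Nat.multichoose_eq, Nat.choose_symm_add,
      Nat.choose_mul (by lia), mul_comm]
    congr 2 <;> lia

theorem tsum_multichoose_mul_choose (k j : ℕ) :
    ∑' l : ℕ, (k.multichoose l : ℝ≥0∞) * (2⁻¹ ^ l * (l.choose j : ℝ≥0∞)) =
      2 ^ k * k.multichoose j := by
  have hzero : ∀ l ∉ Set.range (j + ·),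
      (k.multichoose l : ℝ≥0∞) * (2⁻¹ ^ l * (l.choose j : ℝ≥0∞)) = 0 := fun l hl => by
    rw [Nat.choose_eq_zero_of_lt (not_le.1 fun h => hl ⟨l - j, Nat.add_sub_cancel' h⟩)]
    simp
  have hterm (m : ℕ) : (k.multichoose (j + m) : ℝ≥0∞) * (2⁻¹ ^ (j + m) *
      ((j + m).choose j : ℝ≥0∞)) =
        k.multichoose j * 2⁻¹ ^ j * ((k + j).multichoose m * 2⁻¹ ^ m) := by
    have hcast : (k.multichoose (j + m) : ℝ≥0∞) * ((j + m).choose j : ℝ≥0∞) =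
        k.multichoose j * (k + j).multichoose m := by exact_mod_cast multichoose_mul_choose k j m
    rw [mul_left_comm, hcast, pow_add]
    ring
  rw [← (add_right_injective j).tsum_eq (Function.support_subset_iff'.2 hzero)]
  simp only [hterm, ENNReal.tsum_mul_left, tsum_multichoose_mul_inv_two_pow]
  have hcancel : (2⁻¹ : ℝ≥0∞) ^ j * 2 ^ j = 1 := by
    rw [← mul_pow, ENNReal.inv_mul_cancel two_ne_zero ENNReal.ofNat_ne_top, one_pow]
  calc (k.multichoose j : ℝ≥0∞) * 2⁻¹ ^ j * 2 ^ (k + j)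
      = 2⁻¹ ^ j * 2 ^ j * (2 ^ k * k.multichoose j) := by ring
    _ = 2 ^ k * k.multichoose j := by rw [hcancel, one_mul]

theorem multichoose_succ_eq_sum (k n : ℕ) :
    k.multichoose (n + 1) = ∑ i ∈ Finset.range (n + 1), n.choose i * k.choose (i + 1) := by
  rw [Nat.multichoose_eq, ← Nat.add_assoc, Nat.add_sub_cancel, Nat.add_choose_eq,
    Finset.Nat.sum_antidiagonal_eq_sum_range_succ (fun a b => k.choose a * n.choose b),
    Finset.sum_range_succ']
  simp only [Nat.sub_zero, Nat.choose_succ_self, mul_zero, add_zero, Nat.add_sub_add_right]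
  refine Finset.sum_congr rfl fun i hi => ?_
  rw [Nat.choose_symm (Finset.mem_range_succ_iff.1 hi), mul_comm]

theorem mul_choose_add_one (l n : ℕ) :
    l * l.choose (n + 1) = (n + 1) * l.choose (n + 1) + (n + 2) * l.choose (n + 2) := by
  have hsucc := Nat.choose_succ_right_eq l (n + 1)
  rcases Nat.lt_or_ge l (n + 1) with h | h
  · simp [Nat.choose_eq_zero_of_lt, h, h.trans (Nat.lt_succ_self _)]
  · obtain ⟨m, rfl⟩ := Nat.exists_eq_add_of_le h
    rw [Nat.add_sub_cancel_left] at hsucc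
    linarith

theorem hasSum_pow_div_factorial_mul_affine (x a b : ℝ) :
    HasSum (fun n : ℕ => x ^ n / n.factorial * (a + b * n)) ((a + b * x) * Real.exp x) := by
  have hexp : HasSum (fun n : ℕ => x ^ n / (n.factorial : ℝ)) (Real.exp x) := by
    rw [Real.exp_eq_exp_ℝ]
    exact NormedSpace.expSeries_div_hasSum_exp x
  have hmoment : HasSum (fun n : ℕ => x ^ n / n.factorial * n) (x * Real.exp x) := by
    rw [← hasSum_nat_add_iff' 1]
    simp only [Finset.range_one, Finset.sum_singleton, Nat.cast_zero, mul_zero, sub_zero]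
    refine (hexp.mul_left x).congr_fun fun n => ?_
    rw [Nat.factorial_succ, Nat.cast_mul, pow_succ]
    field_simp
  rw [add_mul, mul_assoc b]
  exact ((hexp.mul_left a).add (hmoment.mul_left b)).congr_fun fun n => by ring

end Binomial

namespace PlanarTree

section LevelSum

/-- The trees of height at most `r`. -/
abbrev BallTree (r : ℕ) := {T : PlanarTree // T.ball r = T}

/-- The sum of a function of the size of the level `r` over the trees of height at most `r`, each
tree being weighted by a factor `1 / 4` for every edge but the root edge. -/
noncomputable def levelSum (r : ℕ) (φ : ℕ → ℝ≥0∞) : ℝ≥0∞ :=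
  ∑' T : BallTree r, 4⁻¹ ^ (T.1.edgesUpTo r - 1) * φ (T.1.levelCard r)

theorem levelSum_tsum_mul {ι : Type*} (r : ℕ) (c : ι → ℝ≥0∞) (φ : ι → ℕ → ℝ≥0∞) :
    levelSum r (fun k => ∑' i, c i * φ i k) = ∑' i, c i * levelSum r (φ i) := by
  simp only [levelSum, ← ENNReal.tsum_mul_left]
  rw [ENNReal.tsum_comm]
  exact tsum_congr fun i => tsum_congr fun T => mul_left_comm _ _ _

theorem levelSum_one (φ : ℕ → ℝ≥0∞) : levelSum 1 φ = φ 1 := by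
  have hpath : (path 1).ball 1 = path 1 := (ball_eq_self_iff _ le_rfl).2 (by simp [path])
  rw [levelSum, tsum_eq_single ⟨path 1, hpath⟩]
  · simp [edgesUpTo, levelCard_one]
  · rintro ⟨T, hT⟩ hne
    exact absurd (Subtype.ext (hT.symm.trans ((ball_one_eq T (path 1)).trans hpath))) hne

/-- A tree of height at most `r + 1` is a tree of height at most `r` together with a monotone map
giving the parents of the vertices of its level `r + 1`. -/
noncomputable def ballTreeSuccEquiv (r : ℕ) (hr : 1 ≤ r) :
    (Σ T : BallTree r, Σ l : ℕ, (Fin l →o Fin (T.1.levelCard r))) ≃ BallTree (r + 1) :=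
  Equiv.ofBijective (fun p => ⟨p.1.1.extend r hr p.2.2, ball_succ_extend _ r hr _⟩) <| by
    constructor
    · rintro ⟨⟨T, hT⟩, p⟩ ⟨⟨T', hT'⟩, p'⟩ heq
      have hextend : T.extend r hr p.2 = T'.extend r hr p'.2 := congrArg Subtype.val heq
      have hball := congrArg (fun S => ball S r) hextend
      simp only [ball_extend, hT, hT'] at hball
      subst hball
      rw [T.extend_injective r hr hextend]
    · rintro ⟨S, hS⟩
      obtain ⟨f, hf⟩ := (S.ball r).exists_extend_eq r hr rfl
      exact ⟨⟨⟨S.ball r, S.ball_ball le_rfl⟩, _, f⟩, Subtype.ext (hf.trans hS)⟩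

theorem levelSum_succ {r : ℕ} (hr : 1 ≤ r) (φ : ℕ → ℝ≥0∞) :
    levelSum (r + 1) φ =
      levelSum r fun k => ∑' l : ℕ, (k.multichoose l : ℝ≥0∞) * (4⁻¹ ^ l * φ l) := by
  rw [levelSum, ← (ballTreeSuccEquiv r hr).tsum_eq, ENNReal.tsum_sigma', levelSum]
  refine tsum_congr fun T => ?_
  rw [ENNReal.tsum_sigma', ← ENNReal.tsum_mul_left]
  refine tsum_congr fun l => ?_
  have hterm (f : Fin l →o Fin (T.1.levelCard r)) :
      (4⁻¹ : ℝ≥0∞) ^ ((T.1.extend r hr f).edgesUpTo (r + 1) - 1) *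
          φ ((T.1.extend r hr f).levelCard (r + 1)) =
        4⁻¹ ^ (T.1.edgesUpTo r - 1) * (4⁻¹ ^ l * φ l) := by
    rw [edgesUpTo_extend, levelCard_extend, Nat.sub_add_comm (T.1.one_le_edgesUpTo hr), pow_add,
      mul_assoc]
  refine (tsum_congr hterm).trans ?_
  rw [tsum_fintype, Finset.sum_const, Finset.card_univ, card_orderHom_fin, nsmul_eq_mul,
    mul_left_comm]

theorem levelSum_two_pow_mul_choose (R n : ℕ) :
    levelSum (R + 1) (fun k => 2 ^ k * (k.choose (n + 1) : ℝ≥0∞)) = 2 * R ^ n := by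
  induction R generalizing n with
  | zero => cases n <;> simp [levelSum_one, Nat.choose_eq_zero_of_lt]
  | succ R ih =>
    have hquarter : (4⁻¹ * 2 : ℝ≥0∞) = 2⁻¹ := by
      rw [show (4 : ℝ≥0∞) = 2 * 2 by norm_num, ENNReal.mul_inv (by simp) (by simp), mul_assoc,
        ENNReal.inv_mul_cancel two_ne_zero ENNReal.ofNat_ne_top, mul_one]
    have hlevel (k : ℕ) : ∑' l : ℕ, (k.multichoose l : ℝ≥0∞) *
        (4⁻¹ ^ l * (2 ^ l * (l.choose (n + 1) : ℝ≥0∞))) =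
          ∑' i : Fin (n + 1), (n.choose i : ℝ≥0∞) * (2 ^ k * (k.choose (i + 1) : ℝ≥0∞)) := by
      simp only [← mul_assoc (4⁻¹ ^ _ : ℝ≥0∞), ← mul_pow, hquarter]
      rw [tsum_multichoose_mul_choose, multichoose_succ_eq_sum, Finset.sum_range, tsum_fintype]
      push_cast
      rw [Finset.mul_sum]
      exact Finset.sum_congr rfl fun i _ => mul_left_comm _ _ _
    rw [levelSum_succ (by lia)]
    simp only [hlevel, levelSum_tsum_mul, ih]
    rw [tsum_fintype, ← Finset.sum_range fun i => (n.choose i : ℝ≥0∞) * (2 * (R : ℝ≥0∞) ^ i),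
      Nat.cast_succ, add_pow, Finset.mul_sum]
    exact Finset.sum_congr rfl fun i _ => by ring

theorem levelSum_mul_two_pow_mul_choose (R n : ℕ) :
    levelSum (R + 1) (fun k => k * (2 ^ k * (k.choose (n + 1) : ℝ≥0∞))) =
      2 * ((n + 1) * R ^ n + (n + 2) * R ^ (n + 1)) := by
  have hterm (k : ℕ) : (k * (2 ^ k * (k.choose (n + 1) : ℝ≥0∞))) =
      ∑' i : Fin 2, (n + 1 + i : ℝ≥0∞) * (2 ^ k * (k.choose (n + i + 1) : ℝ≥0∞)) := by
    have hcast : (k * k.choose (n + 1) : ℝ≥0∞) =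
        (n + 1) * k.choose (n + 1) + (n + 2) * k.choose (n + 2) := by
      exact_mod_cast mul_choose_add_one k n
    rw [mul_left_comm, hcast, tsum_fintype, Fin.sum_univ_two]
    simp only [Fin.val_zero, Fin.val_one, add_zero, Nat.cast_zero, Nat.cast_one]
    ring
  simp only [hterm, levelSum_tsum_mul, levelSum_two_pow_mul_choose]
  rw [tsum_fintype, Fin.sum_univ_two]
  simp only [Fin.val_zero, Fin.val_one, add_zero, Nat.cast_zero, Nat.cast_one]
  ring

end LevelSum

section LimitMoments

variable {μ : ℝ}

theorem ofReal_limitWeight (hμ : 0 ≤ μ) (k : ℕ) :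
    ENNReal.ofReal (limitWeight μ k) = ∑' n : ℕ, ENNReal.ofReal (μ ^ n / n.factorial / 2) *
      (2 ^ k * (k.choose (n + 1) : ℝ≥0∞)) := by
  have hterm (n : ℕ) : ENNReal.ofReal (μ ^ n / n.factorial / 2) *
      (2 ^ k * (k.choose (n + 1) : ℝ≥0∞)) =
        ENNReal.ofReal (2 ^ k * (k.choose (n + 1) * μ ^ n / n.factorial) / 2) := by
    rw [show (2 ^ k * (k.choose (n + 1) : ℝ≥0∞)) =
        ENNReal.ofReal (2 ^ k * (k.choose (n + 1) : ℝ)) by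
      rw [ENNReal.ofReal_mul (by positivity), ENNReal.ofReal_pow zero_le_two, ENNReal.ofReal_ofNat,
        ENNReal.ofReal_natCast], ← ENNReal.ofReal_mul (by positivity)]
    ring_nf
  have hvanish : ∀ n ∉ Finset.range k,
      ENNReal.ofReal (2 ^ k * (k.choose (n + 1) * μ ^ n / n.factorial) / 2) = 0 := fun n hn => by
    rw [Nat.choose_eq_zero_of_lt (by simpa [Nat.lt_succ_iff] using hn)]
    simp
  rw [tsum_congr hterm, tsum_eq_sum hvanish, limitWeight, Finset.mul_sum, Finset.sum_div,
    ENNReal.ofReal_sum_of_nonneg fun n _ => by positivity]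

theorem tsum_cylinderLimit_mul (hμ : 0 ≤ μ) {R : ℕ} {a b : ℝ} (ha : 0 ≤ a) (hb : 0 ≤ b)
    {f : ℕ → ℝ≥0∞} (hf : ∀ n : ℕ, levelSum (R + 1) (fun k => f k *
      (2 ^ k * (k.choose (n + 1) : ℝ≥0∞))) = ENNReal.ofReal (2 * ((a + b * n) * R ^ n))) :
    ∑' T : BallTree (R + 1), ENNReal.ofReal (cylinderLimit μ T.1 (R + 1)) *
      f (T.1.levelCard (R + 1)) = ENNReal.ofReal (a + b * (μ * R)) := by
  have hterm (T : BallTree (R + 1)) : ENNReal.ofReal (cylinderLimit μ T.1 (R + 1)) *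
      f (T.1.levelCard (R + 1)) = ENNReal.ofReal (Real.exp (-(μ * R))) *
        (4⁻¹ ^ (T.1.edgesUpTo (R + 1) - 1) * ∑' n : ℕ, ENNReal.ofReal (μ ^ n / n.factorial / 2) *
          (f (T.1.levelCard (R + 1)) *
            (2 ^ T.1.levelCard (R + 1) * ((T.1.levelCard (R + 1)).choose (n + 1) : ℝ≥0∞)))) := by
    simp only [mul_left_comm _ (f _)]
    rw [ENNReal.tsum_mul_left, ← ofReal_limitWeight hμ, cylinderLimit, Nat.add_sub_cancel,
      ← Real.exp_nat_mul, ENNReal.ofReal_mul (by positivity), ENNReal.ofReal_mul (by positivity),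
      ENNReal.ofReal_pow (by positivity), one_div, ENNReal.ofReal_inv_of_pos four_pos,
      ENNReal.ofReal_ofNat]
    ring_nf
  have hmoment := hasSum_pow_div_factorial_mul_affine (μ * R) a b
  have hcoeff (n : ℕ) : ENNReal.ofReal (μ ^ n / n.factorial / 2) *
      ENNReal.ofReal (2 * ((a + b * n) * R ^ n)) =
        ENNReal.ofReal ((μ * R) ^ n / n.factorial * (a + b * n)) := by
    rw [← ENNReal.ofReal_mul (by positivity), mul_pow]
    ring_nf
  have hlevel := levelSum_tsum_mul (R + 1) (fun n : ℕ => ENNReal.ofReal (μ ^ n / n.factorial / 2))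
    fun n k => f k * (2 ^ k * (k.choose (n + 1) : ℝ≥0∞))
  simp only [hf, hcoeff] at hlevel
  rw [tsum_congr hterm, ENNReal.tsum_mul_left]
  refine (congrArg _ hlevel).trans ?_
  rw [← ENNReal.ofReal_tsum_of_nonneg (fun n => by positivity) hmoment.summable, hmoment.tsum_eq,
    ← ENNReal.ofReal_mul (by positivity), mul_left_comm, ← Real.exp_add, neg_add_cancel,
    Real.exp_zero, mul_one]

theorem tsum_cylinderLimit (hμ : 0 ≤ μ) (R : ℕ) :
    ∑' T : BallTree (R + 1), ENNReal.ofReal (cylinderLimit μ T.1 (R + 1)) = 1 := by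
  have hsum := tsum_cylinderLimit_mul hμ (R := R) (f := 1) zero_le_one le_rfl fun n => by
    simp only [Pi.one_apply, one_mul, levelSum_two_pow_mul_choose, zero_mul, add_zero]
    rw [ENNReal.ofReal_mul zero_le_two, ENNReal.ofReal_pow (by positivity), ENNReal.ofReal_ofNat,
      ENNReal.ofReal_natCast]
  simpa using hsum

theorem tsum_cylinderLimit_mul_levelCard (hμ : 0 ≤ μ) (R : ℕ) :
    ∑' T : BallTree (R + 1), ENNReal.ofReal (cylinderLimit μ T.1 (R + 1)) *
      (T.1.levelCard (R + 1) : ℝ≥0∞) = ENNReal.ofReal (1 + 2 * R + (1 + R) * (μ * R)) := by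
  refine tsum_cylinderLimit_mul hμ (f := (↑)) (by positivity) (by positivity) fun n => ?_
  have hcast : 2 * ((1 + 2 * R + (1 + R) * n) * R ^ n : ℝ) =
      (2 * ((n + 1) * R ^ n + (n + 2) * R ^ (n + 1)) : ℕ) := by
    push_cast
    ring
  rw [levelSum_mul_two_pow_mul_choose, hcast, ENNReal.ofReal_natCast]
  push_cast
  rfl

end LimitMoments

section Topology

theorem ball_eq_of_dist_lt {T T' : PlanarTree} {r : ℕ} (hr : 1 ≤ r)
    (h : dist T T' < 1 / (r : ℝ)) : T.ball r = T'.ball r := by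
  obtain ⟨_, ⟨s, hs, hball, rfl⟩, hlt⟩ := exists_lt_of_csInf_lt (agreement_nonempty T T') h
  have hrs := (one_div_lt_one_div (Nat.cast_pos.2 hs) (Nat.cast_pos.2 hr)).1 hlt
  exact ball_eq_of_le (Nat.cast_lt.1 hrs).le hball

theorem dist_le_of_ball_eq {T T' : PlanarTree} {r : ℕ} (hr : 1 ≤ r) (h : T.ball r = T'.ball r) :
    dist T T' ≤ 1 / (r : ℝ) :=
  csInf_le (agreement_bddBelow T T') ⟨r, hr, h, rfl⟩

theorem isLocallyConstant_ball {r : ℕ} (hr : 1 ≤ r) :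
    IsLocallyConstant fun T : PlanarTree => T.ball r := by
  refine (IsLocallyConstant.iff_eventually_eq _).2 fun T => ?_
  filter_upwards [Metric.ball_mem_nhds T (one_div_pos.2 (Nat.cast_pos.2 hr))] with T' hT'
  exact ball_eq_of_dist_lt hr hT'

/-- The set of the trees whose ball of radius `r` around the root is `T₀`. -/
def cylinder (T₀ : PlanarTree) (r : ℕ) : Set PlanarTree := {T | T.ball r = T₀}

theorem mem_cylinder {T₀ T : PlanarTree} {r : ℕ} : T ∈ T₀.cylinder r ↔ T.ball r = T₀ := Iff.rfl

theorem isClopen_cylinder (T₀ : PlanarTree) {r : ℕ} (hr : 1 ≤ r) : IsClopen (T₀.cylinder r) :=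
  (isLocallyConstant_ball hr).isClopen_fiber T₀

theorem measurableSet_cylinder (T₀ : PlanarTree) {r : ℕ} (hr : 1 ≤ r) :
    MeasurableSet (T₀.cylinder r) :=
  (T₀.isClopen_cylinder hr).isOpen.measurableSet

theorem pairwise_disjoint_cylinder (r : ℕ) :
    Pairwise fun T T' : BallTree r => Disjoint (T.1.cylinder r) (T'.1.cylinder r) :=
  fun _ _ hne => Set.disjoint_left.2 fun _ h h' => hne (Subtype.ext (h.symm.trans h'))

theorem measurable_levelCard (r : ℕ) : Measurable fun T : PlanarTree => T.levelCard r := by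
  have hball : (fun T : PlanarTree => T.levelCard r) = (levelCard · r) ∘ (ball · (r + 1)) :=
    funext fun T => (levelCard_ball T r.le_succ).symm
  rw [hball]
  exact ((isLocallyConstant_ball (by lia)).comp _).continuous.measurable

theorem exists_cylinder_subset {U : Set PlanarTree} {T : PlanarTree} (hU : U ∈ 𝓝 T) :
    ∃ r, 1 ≤ r ∧ (T.ball r).cylinder r ⊆ U := by
  obtain ⟨ε, hε, hsub⟩ := Metric.mem_nhds_iff.1 hU
  obtain ⟨n, hn⟩ := exists_nat_one_div_lt hε
  refine ⟨n + 1, by lia, fun T' hT' => hsub ((dist_le_of_ball_eq (by lia) hT').trans_lt ?_)⟩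
  exact_mod_cast hn

theorem mem_ofSize_edgesUpTo {T : PlanarTree} {r : ℕ} (hr : 1 ≤ r) (hT : T.ball r = T) :
    T ∈ ofSize (T.edgesUpTo r) :=
  size_eq_edgesUpTo ((T.ball_eq_self_iff_height_le hr).1 hT)

theorem countable_iUnion_ofSize : (⋃ N, ofSize N).Countable :=
  Set.countable_iUnion fun N => (finite_ofSize N).countable

theorem countable_ballTree {r : ℕ} (hr : 1 ≤ r) : Countable (BallTree r) :=
  (countable_iUnion_ofSize.mono fun _ hT =>
    Set.mem_iUnion.2 ⟨_, mem_ofSize_edgesUpTo hr hT⟩).to_subtype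

instance : SecondCountableTopology PlanarTree := by
  have : TopologicalSpace.SeparableSpace PlanarTree := by
    refine ⟨⋃ N, ofSize N, countable_iUnion_ofSize, fun T => mem_closure_iff_nhds.2 fun U hU => ?_⟩
    obtain ⟨r, hr, hsub⟩ := exists_cylinder_subset hU
    have hball : (T.ball r).ball r = T.ball r := T.ball_ball le_rfl
    exact ⟨T.ball r, hsub hball, Set.mem_iUnion.2 ⟨_, mem_ofSize_edgesUpTo hr hball⟩⟩
  exact UniformSpace.secondCountable_of_separable PlanarTree

theorem cylinder_subset_of_le {T T' : PlanarTree} {r r' : ℕ} (hrr' : r ≤ r')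
    (hne : (T.cylinder r ∩ T'.cylinder r').Nonempty) : T'.cylinder r' ⊆ T.cylinder r := by
  obtain ⟨S, hS, hS'⟩ := hne
  exact fun S' hS'' => (ball_eq_of_le hrr' (hS''.trans hS'.symm)).trans hS

theorem isPiSystem_cylinder :
    IsPiSystem {s : Set PlanarTree | ∃ (r : ℕ) (T₀ : PlanarTree), 1 ≤ r ∧ T₀.ball r = T₀ ∧
      s = T₀.cylinder r} := by
  rintro _ ⟨r, T, hr, hT, rfl⟩ _ ⟨r', T', hr', hT', rfl⟩ hne
  rcases le_total r r' with hle | hle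
  · rw [Set.inter_eq_right.2 (cylinder_subset_of_le hle hne)]
    exact ⟨r', T', hr', hT', rfl⟩
  · rw [Set.inter_eq_left.2 (cylinder_subset_of_le hle (Set.inter_comm _ _ ▸ hne))]
    exact ⟨r, T, hr, hT, rfl⟩

end Topology

section Compactness

theorem levelCard_eq_of_coherent {t : ℕ → PlanarTree}
    (ht : ∀ r s, 1 ≤ r → r ≤ s → (t s).ball r = t r) {r s : ℕ} (hr : 1 ≤ r) (hs : s ≤ r) :
    (t r).levelCard s = (t (s + 1)).levelCard s := by
  rcases hs.lt_or_eq with hlt | rfl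
  · rw [← ht (s + 1) r (by lia) hlt, levelCard_ball _ s.le_succ]
  · rw [← ht s (s + 1) hr s.le_succ, levelCard_ball _ le_rfl]

theorem parent_eq_of_coherent {t : ℕ → PlanarTree}
    (ht : ∀ r s, 1 ≤ r → r ≤ s → (t s).ball r = t r) {r s : ℕ} (hs : s < r) :
    (t r).parent s = (t (s + 1)).parent s := by
  funext i
  rw [← ht (s + 1) r (by lia) hs, parent_ball _ (by lia)]

/-- The tree whose balls of radius `r ≥ 1` are the members `t r` of a coherent family. -/
def glue (t : ℕ → PlanarTree) (ht : ∀ r s, 1 ≤ r → r ≤ s → (t s).ball r = t r) : PlanarTree where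
  levelCard s := (t (s + 1)).levelCard s
  parent s := (t (s + 1)).parent s
  levelCard_zero := levelCard_zero _
  levelCard_one := levelCard_one _
  parent_lt s i h := by
    rw [← levelCard_eq_of_coherent ht (by lia) le_rfl] at h
    exact (t (s + 1)).parent_lt s i h
  parent_mono s i j hij h := by
    rw [← levelCard_eq_of_coherent ht (by lia) le_rfl] at h
    exact (t (s + 1)).parent_mono s i j hij h
  parent_outside s i h := by
    rw [← levelCard_eq_of_coherent ht (by lia) le_rfl] at h
    exact (t (s + 1)).parent_outside s i h

theorem ball_glue {t : ℕ → PlanarTree} (ht : ∀ r s, 1 ≤ r → r ≤ s → (t s).ball r = t r)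
    {r : ℕ} (hr : 1 ≤ r) : (glue t ht).ball r = t r := by
  rw [← ht r r hr le_rfl]
  ext s i
  · simp only [ball, max_eq_left hr, glue]
    exact ite_congr rfl (fun hs => (levelCard_eq_of_coherent ht hr hs).symm) fun _ => rfl
  · simp only [ball, max_eq_left hr, glue]
    exact ite_congr rfl (fun hs => by rw [parent_eq_of_coherent ht hs]) fun _ => rfl

theorem levelCard_ball_le (T : PlanarTree) (r s : ℕ) : (T.ball r).levelCard s ≤ T.levelCard s := by
  simp only [ball]
  split_ifs <;> simp

theorem finite_setOf_ball_eq_self_levelCard_le (c : ℕ → ℕ) {r : ℕ} (hr : 1 ≤ r) :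
    {T : PlanarTree | T.ball r = T ∧ ∀ s, T.levelCard s ≤ c s}.Finite := by
  refine ((Set.finite_Iic (∑ s ∈ Finset.range r, c (s + 1))).biUnion
    fun N _ => finite_ofSize N).subset fun T hT => ?_
  exact Set.mem_biUnion (Finset.sum_le_sum fun s _ => hT.2 (s + 1)) (mem_ofSize_edgesUpTo hr hT.1)

theorem exists_cylinder_mem_of_levelCard_le {c : ℕ → ℕ} {f : Ultrafilter PlanarTree}
    (hf : {T : PlanarTree | ∀ s, T.levelCard s ≤ c s} ∈ f) {r : ℕ} (hr : 1 ≤ r) :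
    ∃ S : PlanarTree, S.cylinder r ∈ f := by
  obtain ⟨S, -, hS⟩ := (Ultrafilter.finite_biUnion_mem_iff
    (finite_setOf_ball_eq_self_levelCard_le c hr) (s := (cylinder · r))).1
      (mem_of_superset hf fun T hT => Set.mem_biUnion
        ⟨T.ball_ball le_rfl, fun s => (levelCard_ball_le T r s).trans (hT s)⟩ rfl)
  exact ⟨S, hS⟩

theorem isCompact_setOf_levelCard_le (c : ℕ → ℕ) :
    IsCompact {T : PlanarTree | ∀ s, T.levelCard s ≤ c s} := by
  refine isCompact_iff_ultrafilter_le_nhds.2 fun f hf => ?_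
  have hbounded := le_principal_iff.1 hf
  have hcylinder (r : ℕ) : ∃ S : PlanarTree, 1 ≤ r → S.cylinder r ∈ f := by
    by_cases hr : 1 ≤ r
    · exact (exists_cylinder_mem_of_levelCard_le hbounded hr).imp fun _ hS _ => hS
    · exact ⟨default, fun h => absurd h hr⟩
  choose t ht using hcylinder
  have hcoherent : ∀ r s, 1 ≤ r → r ≤ s → (t s).ball r = t r := fun r s hr hrs => by
    obtain ⟨S, hSr, hSs⟩ := f.nonempty_of_mem (inter_mem (ht r hr) (ht s (hr.trans hrs)))
    rw [← mem_cylinder.1 hSs, ball_ball _ hrs, mem_cylinder.1 hSr]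
  refine ⟨glue t hcoherent, fun s => ?_, fun U hU => ?_⟩
  · obtain ⟨S, hS, hSc⟩ := f.nonempty_of_mem (inter_mem (ht (s + 1) (by lia)) hbounded)
    rw [← levelCard_ball _ s.le_succ, ball_glue _ (by lia), ← mem_cylinder.1 hS,
      levelCard_ball _ s.le_succ]
    exact hSc s
  · obtain ⟨r, hr, hsub⟩ := exists_cylinder_subset hU
    rw [ball_glue _ hr] at hsub
    exact mem_of_superset (ht r hr) hsub

end Compactness

end PlanarTree

section Tightness

theorem exists_finset_eventually_measure_compl_le {ι α Ω : Type*} [MeasurableSpace Ω]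
    {l : Filter α} {P : α → Measure Ω} [∀ a, IsProbabilityMeasure (P a)] {A : ι → Set Ω}
    (hmeas : ∀ i, MeasurableSet (A i)) (hdisj : Pairwise fun i j => Disjoint (A i) (A j))
    {p : ι → ℝ≥0∞} (hlim : ∀ i, Tendsto (fun a => P a (A i)) l (𝓝 (p i))) (hp : ∑' i, p i = 1)
    {δ : ℝ≥0∞} (hδ : δ ≠ 0) : ∃ F : Finset ι, ∀ᶠ a in l, P a (⋃ i ∈ F, A i)ᶜ ≤ δ := by
  have hsum : HasSum p 1 := hp ▸ ENNReal.summable.hasSum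
  obtain ⟨F, hF⟩ := (hsum.eventually
    (lt_mem_nhds (ENNReal.sub_lt_self ENNReal.one_ne_top one_ne_zero hδ))).exists
  refine ⟨F, ((tendsto_finsetSum F fun i _ => hlim i).eventually (lt_mem_nhds hF)).mono
    fun a ha => ?_⟩
  rw [prob_compl_eq_one_sub (F.measurableSet_biUnion fun i _ => hmeas i),
    measure_biUnion_finset (fun i _ j _ hij => hdisj hij) fun i _ => hmeas i]
  exact tsub_le_iff_tsub_le.1 ha.le

end Tightness

namespace PlanarTree

section Limit

variable {μ : ℝ}

theorem finiteSizeLaw_apply (μ : ℝ) (N : ℕ+) {A : Set PlanarTree} [DecidablePred (· ∈ A)]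
    (hA : MeasurableSet A) :
    (finiteSizeLaw μ N : Measure PlanarTree) A = ENNReal.ofReal
      ((∑ T ∈ (finite_ofSize N).toFinset with T ∈ A, weight μ T) / partitionFunction μ N) := by
  have hnonneg (T : PlanarTree) : 0 ≤ weight μ T / partitionFunction μ N :=
    div_nonneg (Real.exp_nonneg _) (partitionFunction_pos μ N.pos).le
  change finiteSizeMeasure μ N A = _
  rw [Finset.sum_div, ENNReal.ofReal_sum_of_nonneg fun T _ => hnonneg T, Finset.sum_filter]
  simp only [finiteSizeMeasure, Measure.coe_finsetSum, Finset.sum_apply, Measure.smul_apply,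
    Measure.dirac_apply' _ hA, smul_eq_mul, Set.indicator_apply, Pi.one_apply, mul_ite, mul_one,
    mul_zero]

theorem tendsto_finiteSizeLaw_cylinder (hμ : 0 < μ) {T : PlanarTree} {r : ℕ} (hr : 1 ≤ r)
    (hT : T.ball r = T) :
    Tendsto (fun N => (finiteSizeLaw μ N : Measure PlanarTree) (T.cylinder r)) atTop
      (𝓝 (ENNReal.ofReal (cylinderLimit μ T r))) := by
  classical
  simp only [finiteSizeLaw_apply μ _ (T.measurableSet_cylinder hr)]
  exact (ENNReal.tendsto_ofReal (tendsto_cylinderWeight_div hμ hr hT)).comp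
    tendsto_PNat_val_atTop_atTop

theorem finiteSizeLaw_lt_levelCard (μ : ℝ) {N : ℕ+} {r c : ℕ} (hr : 1 ≤ r) (hc : N ≤ c) :
    (finiteSizeLaw μ N : Measure PlanarTree) {T | c < T.levelCard r} = 0 := by
  obtain ⟨s, rfl⟩ := Nat.exists_eq_add_of_le' hr
  have hbound : ∀ T ∈ (finite_ofSize N).toFinset, ¬ c < T.levelCard (s + 1) := fun T hT =>
    not_lt.2 ((levelCard_le_of_mem ((Set.Finite.mem_toFinset _).1 hT) s).trans hc)
  rw [finiteSizeLaw_apply μ N (measurableSet_lt measurable_const (measurable_levelCard _)),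
    Finset.sum_eq_zero, zero_div, ENNReal.ofReal_zero]
  intro T hT
  rw [Finset.mem_filter] at hT
  exact absurd hT.2 (hbound T hT.1)

theorem exists_forall_finiteSizeLaw_lt_levelCard_le (hμ : 0 < μ) {r : ℕ} (hr : 1 ≤ r) {δ : ℝ≥0∞}
    (hδ : δ ≠ 0) :
    ∃ c : ℕ, ∀ N, (finiteSizeLaw μ N : Measure PlanarTree) {T | c < T.levelCard r} ≤ δ := by
  obtain ⟨R, rfl⟩ := Nat.exists_eq_add_of_le' hr
  obtain ⟨F, hF⟩ := exists_finset_eventually_measure_compl_le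
    (fun T : BallTree (R + 1) => T.1.measurableSet_cylinder hr) (pairwise_disjoint_cylinder _)
    (fun T => tendsto_finiteSizeLaw_cylinder hμ hr T.2) (tsum_cylinderLimit hμ.le R) hδ
  obtain ⟨N₀, hN₀⟩ := eventually_atTop.1 hF
  refine ⟨max (F.sup fun T => T.1.levelCard (R + 1)) N₀, fun N => ?_⟩
  rcases le_or_gt N N₀ with hN | hN
  · rw [finiteSizeLaw_lt_levelCard μ hr (le_max_of_le_right (PNat.coe_le_coe _ _ |>.2 hN))]
    exact zero_le
  · refine (measure_mono fun S hS hmem => ?_).trans (hN₀ N hN.le)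
    obtain ⟨T, hT, hST⟩ := Set.mem_iUnion₂.1 hmem
    refine not_lt.2 (le_max_of_le_left ?_) (Set.mem_ofPred_eq ▸ hS)
    rw [← levelCard_ball S le_rfl, mem_cylinder.1 hST]
    exact Finset.le_sup (f := fun T : BallTree (R + 1) => T.1.levelCard (R + 1)) hT

theorem isTightMeasureSet_range_finiteSizeLaw (hμ : 0 < μ) :
    IsTightMeasureSet {((P : ProbabilityMeasure PlanarTree) : Measure PlanarTree) |
      P ∈ Set.range (finiteSizeLaw μ)} := by
  refine isTightMeasureSet_iff_exists_isCompact_measure_compl_le.2 fun ε hε => ?_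
  obtain ⟨δ, hδ, hsum⟩ := ENNReal.exists_pos_sum_of_countable hε.ne' ℕ
  have hbound (r : ℕ) : ∃ c : ℕ, ∀ N,
      (finiteSizeLaw μ N : Measure PlanarTree) {T | c < T.levelCard r} ≤ δ r := by
    rcases Nat.eq_zero_or_pos r with rfl | hr
    · exact ⟨1, fun N => by simp [levelCard_zero]⟩
    · exact exists_forall_finiteSizeLaw_lt_levelCard_le hμ hr (ENNReal.coe_ne_zero.2 (hδ r).ne')
  choose c hc using hbound
  refine ⟨_, isCompact_setOf_levelCard_le c, ?_⟩
  rintro _ ⟨_, ⟨N, rfl⟩, rfl⟩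
  have hcompl : {T : PlanarTree | ∀ r, T.levelCard r ≤ c r}ᶜ = ⋃ r, {T | c r < T.levelCard r} := by
    ext T
    simp
  rw [hcompl]
  exact (measure_iUnion_le _).trans ((ENNReal.tsum_le_tsum fun r => hc r N).trans hsum.le)

theorem apply_cylinder_of_mapClusterPt (hμ : 0 < μ) {P : ProbabilityMeasure PlanarTree}
    (hP : MapClusterPt P atTop (finiteSizeLaw μ)) {T : PlanarTree} {r : ℕ} (hr : 1 ≤ r)
    (hT : T.ball r = T) :
    (P : Measure PlanarTree) (T.cylinder r) = ENNReal.ofReal (cylinderLimit μ T r) := by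
  have hcont : Tendsto (fun Q : ProbabilityMeasure PlanarTree =>
      (Q : Measure PlanarTree) (T.cylinder r)) (𝓝 P)
      (𝓝 ((P : Measure PlanarTree) (T.cylinder r))) :=
    ProbabilityMeasure.tendsto_measure_of_null_frontier_of_tendsto' tendsto_id
      (by simp [(isClopen_cylinder T hr).frontier_eq])
  exact eq_of_nhds_neBot
    (ClusterPt.mono (hP.tendsto_comp hcont) (tendsto_finiteSizeLaw_cylinder hμ hr hT))

theorem tendsto_finiteSizeLaw_of_apply_cylinder (hμ : 0 < μ) {P : ProbabilityMeasure PlanarTree}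
    (hP : ∀ r, 1 ≤ r → ∀ T : PlanarTree, T.ball r = T →
      (P : Measure PlanarTree) (T.cylinder r) = ENNReal.ofReal (cylinderLimit μ T r)) :
    Tendsto (finiteSizeLaw μ) atTop (𝓝 P) := by
  refine isPiSystem_cylinder.tendsto_probabilityMeasure_of_tendsto_of_mem ?_ ?_ ?_
  · rintro _ ⟨r, T, hr, -, rfl⟩
    exact T.measurableSet_cylinder hr
  · intro U hU T hT
    obtain ⟨r, hr, hsub⟩ := exists_cylinder_subset (hU.mem_nhds hT)
    exact ⟨_, ⟨r, T.ball r, hr, T.ball_ball le_rfl, rfl⟩,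
      (isClopen_cylinder _ hr).isOpen.mem_nhds rfl, hsub⟩
  · rintro _ ⟨r, T, hr, hT, rfl⟩
    have hlim := tendsto_finiteSizeLaw_cylinder hμ hr hT
    rw [← hP r hr T hT] at hlim
    exact (ENNReal.tendsto_toNNReal (measure_ne_top _ _)).comp hlim

theorem tendsto_finiteSizeLaw (hμ : 0 < μ) :
    Tendsto (finiteSizeLaw μ) atTop (𝓝 (localLimit μ)) := by
  have hcompact := isCompact_closure_of_isTightMeasureSet (isTightMeasureSet_range_finiteSizeLaw hμ)
  obtain ⟨P, -, hP⟩ := hcompact.exists_mapClusterPt (f := atTop) (u := finiteSizeLaw μ)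
    (le_principal_iff.2 (mem_map.2 (Eventually.of_forall fun N =>
      subset_closure (Set.mem_range_self N))))
  exact tendsto_nhds_limUnder ⟨P, tendsto_finiteSizeLaw_of_apply_cylinder hμ
    fun r hr T hT => apply_cylinder_of_mapClusterPt hμ hP hr hT⟩

theorem localLimit_cylinder (hμ : 0 < μ) {T : PlanarTree} {r : ℕ} (hr : 1 ≤ r)
    (hT : T.ball r = T) :
    (localLimit μ : Measure PlanarTree) (T.cylinder r) = ENNReal.ofReal (cylinderLimit μ T r) :=
  apply_cylinder_of_mapClusterPt hμ (tendsto_finiteSizeLaw hμ).mapClusterPt hr hT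

end Limit

section Moments

variable {μ : ℝ}

theorem lintegral_comp_levelCard (P : Measure PlanarTree) {r : ℕ} (hr : 1 ≤ r) (f : ℕ → ℝ≥0∞) :
    ∫⁻ T, f (T.levelCard r) ∂P =
      ∑' T : BallTree r, P (T.1.cylinder r) * f (T.1.levelCard r) := by
  have hcountable := countable_ballTree hr
  let toBall (T : PlanarTree) : BallTree r := ⟨T.ball r, T.ball_ball le_rfl⟩
  have hfiber (T : BallTree r) : toBall ⁻¹' {T} = T.1.cylinder r := Set.ext fun S => Subtype.ext_iff
  have hmeas : Measurable toBall := measurable_to_countable' fun T => by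
    rw [hfiber]
    exact T.1.measurableSet_cylinder hr
  have hcomp (T : PlanarTree) : f (T.levelCard r) = f ((toBall T).1.levelCard r) := by
    rw [levelCard_ball _ le_rfl]
  rw [lintegral_congr hcomp, ← lintegral_map (f := fun S : BallTree r => f (S.1.levelCard r))
    (measurable_of_countable _) hmeas, lintegral_countable']
  refine tsum_congr fun T => ?_
  rw [Measure.map_apply hmeas (measurableSet_singleton T), hfiber, mul_comm]

theorem lintegral_levelCard (hμ : 0 < μ) {r : ℕ} (hr : 1 ≤ r) :
    ∫⁻ T : PlanarTree, ENNReal.ofReal (T.levelCard r) ∂(localLimit μ : Measure PlanarTree) =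
      ENNReal.ofReal (2 * r - 1 + μ * r * (r - 1)) := by
  obtain ⟨R, rfl⟩ := Nat.exists_eq_add_of_le' hr
  simp only [ENNReal.ofReal_natCast]
  rw [lintegral_comp_levelCard _ hr (fun k => (k : ℝ≥0∞)),
    tsum_congr fun T => by rw [localLimit_cylinder hμ hr T.2],
    tsum_cylinderLimit_mul_levelCard hμ.le]
  congr 1
  push_cast
  ring

theorem integrable_levelCard (hμ : 0 < μ) {r : ℕ} (hr : 1 ≤ r) :
    Integrable (fun T : PlanarTree => (T.levelCard r : ℝ)) (localLimit μ : Measure PlanarTree) := by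
  refine ⟨(measurable_from_top.comp (measurable_levelCard r)).aestronglyMeasurable, ?_⟩
  rw [hasFiniteIntegral_iff_ofReal (Eventually.of_forall fun T => Nat.cast_nonneg _),
    lintegral_levelCard hμ hr]
  exact ENNReal.ofReal_lt_top

theorem integral_levelCard (hμ : 0 < μ) {r : ℕ} (hr : 1 ≤ r) :
    ∫ T : PlanarTree, (T.levelCard r : ℝ) ∂(localLimit μ : Measure PlanarTree) =
      2 * r - 1 + μ * r * (r - 1) := by
  have hr' : (1 : ℝ) ≤ r := Nat.one_le_cast.2 hr
  rw [integral_eq_lintegral_of_nonneg_ae (Eventually.of_forall fun T => Nat.cast_nonneg _)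
    (integrable_levelCard hμ hr).aestronglyMeasurable, lintegral_levelCard hμ hr,
    ENNReal.toReal_ofReal]
  exact add_nonneg (by linarith) (mul_nonneg (by positivity) (by linarith))

theorem toNat_size_ball (T : PlanarTree) {r : ℕ} (hr : 1 ≤ r) :
    (T.ball r).size.toNat = ∑ s ∈ Finset.range r, T.levelCard (s + 1) := by
  rw [size_eq_edgesUpTo (((T.ball r).ball_eq_self_iff_height_le hr).1 (T.ball_ball le_rfl)),
    ENat.toNat_natCast, edgesUpTo_ball, edgesUpTo]

theorem integrable_size_ball (hμ : 0 < μ) {r : ℕ} (hr : 1 ≤ r) :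
    Integrable (fun T : PlanarTree => ((T.ball r).size.toNat : ℝ))
      (localLimit μ : Measure PlanarTree) := by
  simp only [toNat_size_ball _ hr, Nat.cast_sum]
  exact integrable_finsetSum _ fun s _ => integrable_levelCard hμ (by lia)

theorem integral_size_ball (hμ : 0 < μ) {r : ℕ} (hr : 1 ≤ r) :
    ∫ T : PlanarTree, ((T.ball r).size.toNat : ℝ) ∂(localLimit μ : Measure PlanarTree) =
      r ^ 2 + μ / 3 * (r ^ 3 - r) := by
  simp only [toNat_size_ball _ hr, Nat.cast_sum]
  rw [integral_finsetSum _ fun s _ => integrable_levelCard hμ (by lia)]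
  simp only [integral_levelCard hμ (Nat.le_add_left 1 _)]
  clear hr
  induction r with
  | zero => simp
  | succ r ih =>
    rw [Finset.sum_range_succ, ih]
    push_cast
    ring

end Moments

end PlanarTree

theorem isBigO_div_add_div_sq (a b : ℝ) :
    (fun r : ℕ => a / (r : ℝ) + b / (r : ℝ) ^ 2) =O[atTop] fun r : ℕ => 1 / (r : ℝ) := by
  have hone : (fun r : ℕ => 1 / (r : ℝ)) =O[atTop] fun _ => (1 : ℝ) :=
    tendsto_one_div_atTop_nhds_zero_nat.isBigO_one ℝ
  have hself := isBigO_refl (fun r : ℕ => 1 / (r : ℝ)) atTop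
  have hsq : (fun r : ℕ => 1 / (r : ℝ) * (1 / (r : ℝ))) =O[atTop] fun r : ℕ => 1 / (r : ℝ) := by
    simpa only [mul_one] using hself.mul hone
  exact ((hself.const_mul_left a).add (hsq.const_mul_left b)).congr_left fun r => by ring

theorem mainTheorem11 (μ : ℝ) (hμ : 0 < μ) :
    Tendsto (PlanarTree.finiteSizeLaw μ) atTop (𝓝 (PlanarTree.localLimit μ)) ∧
    (∀ r : ℕ, 1 ≤ r → Integrable (fun T : PlanarTree => (T.levelCard r : ℝ))
      (PlanarTree.localLimit μ : Measure PlanarTree)) ∧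
    (∀ r : ℕ, 1 ≤ r → Integrable (fun T : PlanarTree => ((T.ball r).size.toNat : ℝ))
      (PlanarTree.localLimit μ : Measure PlanarTree)) ∧
    (∃ ε : ℕ → ℝ, ε =O[atTop] (fun r : ℕ => 1 / (r : ℝ)) ∧
      ∀ r : ℕ, 1 ≤ r →
        ∫ T : PlanarTree, (T.levelCard r : ℝ) ∂(PlanarTree.localLimit μ : Measure PlanarTree) =
          μ * (r : ℝ) ^ 2 * (1 + ε r)) ∧
    (∃ ε : ℕ → ℝ, ε =O[atTop] (fun r : ℕ => 1 / (r : ℝ)) ∧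
      ∀ r : ℕ, 1 ≤ r →
        ∫ T : PlanarTree, ((T.ball r).size.toNat : ℝ)
            ∂(PlanarTree.localLimit μ : Measure PlanarTree) =
          1 / 3 * μ * (r : ℝ) ^ 3 * (1 + ε r)) := by
  refine ⟨PlanarTree.tendsto_finiteSizeLaw hμ, fun r => PlanarTree.integrable_levelCard hμ,
    fun r => PlanarTree.integrable_size_ball hμ,
    ⟨_, isBigO_div_add_div_sq ((2 - μ) / μ) (-1 / μ), fun r hr => ?_⟩,
    ⟨_, isBigO_div_add_div_sq (3 / μ) (-1), fun r hr => ?_⟩⟩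
  · have hr0 : (r : ℝ) ≠ 0 := Nat.cast_ne_zero.2 (by lia)
    rw [PlanarTree.integral_levelCard hμ hr]
    field_simp
    ring
  · have hr0 : (r : ℝ) ≠ 0 := Nat.cast_ne_zero.2 (by lia)
    rw [PlanarTree.integral_size_ball hμ hr]
    field_simp
    ring
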